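/- Notation. Let $q=\begin{pmatrix}0&1\\1&0\end{pmatrix}$, $Q=\begin{pmatrix}q&0\\0&q\end{pmatrix}$, and for a complex $4\times4$ matrix $M=\begin{pmatrix}A&B\\C&D\end{pmatrix}$ with $2\times2$ blocks put $M\langle Z\rangle=(AZ+B)(CZ+D)^{-1}$. Let $\mathbb H_2$ be the Siegel upper half space of order $2$ (symmetric complex $2\times2$ matrices with positive definite imaginary part), let $\hat{\mathbb H}_2=\{Z\in\mathbb H_2: Q\langle Z\rangle=Z\}$, and let $\hat E_2=\{Z_0\in\mathbb C^{2\times2}: qZ_0=Z_0q,\ I-Z_0\overline{Z_0}>0\}$. Both consist of matrices $\begin{pmatrix}a&b\\b&a\end{pmatrix}$, and through the coordinates $(a,b)$ both are regarded as domains in $\mathbb C^2$. Let $\hat\Omega_2=\{M\in Sp(4,\mathbb R): M\langle Z\rangle\in\hat{\mathbb H}_2\text{ for all }Z\in\hat{\mathbb H}_2\}$ be the motion group of $\hat{\mathbb H}_2$, let $L=\begin{pmatrix}iI&iI\\-I&I\end{pmatrix}$ (so that $Z_0\mapsto L\langle Z_0\rangle=i(I+Z_0)(I-Z_0)^{-1}$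 maps $\hat E_2$ onto $\hat{\mathbb H}_2$), and let $\hat\Omega_{\hat E_2}=L^{-1}\hat\Omega_2L$ be the motion group of $\hat E_2$. Theorem 3. Every biholomorphic map from $\hat E_2$ onto itself has the form $Z_0\mapsto M_0\langle Z_0\rangle$ with $M_0\in\hat\Omega_{\hat E_2}$, and every biholomorphic map from $\hat{\mathbb H}_2$ onto itself has the form $Z\mapsto M\langle Z\rangle$ with $M\in\hat\Omega_2$. Moreover $\{\pm I,\pm Q\}$ is a normal subgroup of $\hat\Omega_2$ and of $\hat\Omega_{\hat E_2}$, and the group of all biholomorphic maps from $\hat E_2$ (respectively $\hat{\mathbb H}_2$) onto itself is isomorphic to $\hat\Omega_{\hat E_2}/\{\pm I,\pm Q\}$ (respectively $\hat\Omega_2/\{\pm I,\pm Q\}$), the class of $M_0$ (respectively $M$) corresponding to the map $Z_0\mapsto M_0\langle Z_0\rangle$ (respectively $Z\mapsto M\langle Z\rangle$). Through the isomorphism $M\mapsto L^{-1}ML$ from $\hat\Omega_2$ onto $\hat\Omega_{\hat E_2}$ the two quotient groups may be interchanged here: the class of $M\in\hat\Omega_2$ corresponds to $Z_0\mapsto(L^{-1}ML)\langle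 Z_0\rangle$ on $\hat E_2$, and the class of $M_0\in\hat\Omega_{\hat E_2}$ to $Z\mapsto(LM_0L^{-1})\langle Z\rangle$ on $\hat{\mathbb H}_2$. -/

import Mathlib

open Matrix
open scoped ComplexOrder

namespace SiegelHat

noncomputable section

/-- `2 × 2` matrices over `R`. -/
abbrev Mat2 (R : Type) : Type := Matrix (Fin 2) (Fin 2) R

/-- `4 × 4` matrices over `R`, written in `2 × 2` blocks. -/
abbrev Mat4 (R : Type) : Type := Matrix (Fin 2 ⊕ Fin 2) (Fin 2 ⊕ Fin 2) R

/-- The matrix `q` with rows `(0, 1)` and `(1, 0)`. -/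
def qMat (R : Type) [CommRing R] : Mat2 R := !![0, 1; 1, 0]

/-- The block diagonal matrix `Q = diag(q, q)`. -/
def QMat (R : Type) [CommRing R] : Mat4 R := fromBlocks (qMat R) 0 0 (qMat R)

/-- The fractional linear action `M⟨Z⟩ = (A Z + B) (C Z + D)⁻¹`. -/
def moebius (M : Mat4 ℂ) (Z : Mat2 ℂ) : Mat2 ℂ :=
  (M.toBlocks₁₁ * Z + M.toBlocks₁₂) * (M.toBlocks₂₁ * Z + M.toBlocks₂₂)⁻¹

/-- The Siegel upper half space of order 2: symmetric complex matrices with positive definite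
imaginary part. -/
def siegelH : Set (Mat2 ℂ) := {Z | Zᵀ = Z ∧ (Z.map Complex.im).PosDef}

/-- The space `Ĥ₂` of the fixed points of `Q` in the Siegel upper half space. -/
def hatH : Set (Mat2 ℂ) := {Z | Z ∈ siegelH ∧ moebius (QMat ℂ) Z = Z}

/-- The domain `Ê₂`: complex matrices `Z` with `q Z = Z q` and `I - Z Z̄` (Hermitian and)
positive definite. -/
def hatE : Set (Mat2 ℂ) :=
  {Z | qMat ℂ * Z = Z * qMat ℂ ∧ (1 - Z * Z.map (starRingEnd ℂ)).PosDef}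

/-- The real symplectic group `Ω₂ = Sp(4, ℝ)`. -/
abbrev Sp4 : Type := symplecticGroup (Fin 2) ℝ

/-- A real symplectic matrix, seen as an invertible complex matrix. -/
def complexify : Sp4 →* (Mat4 ℂ)ˣ :=
  MonoidHom.toHomUnits
    ((Complex.ofRealHom.mapMatrix : Mat4 ℝ →+* Mat4 ℂ).toMonoidHom.comp
      (symplecticGroup (Fin 2) ℝ).subtype)

/-! ### The action of the symplectic group: facts needed to see that `Ω̂₂` is a group -/

lemma complexify_coe (M : Sp4) :
    ((complexify M : (Mat4 ℂ)ˣ) : Mat4 ℂ) = (M : Mat4 ℝ).map Complex.ofReal := rfl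

lemma posDef_map_ofReal_iff (Y : Mat2 ℝ) : (Y.map Complex.ofReal).PosDef ↔ Y.PosDef := by
  rw [posDef_iff_dotProduct_mulVec, posDef_iff_dotProduct_mulVec]
  constructor
  · rintro ⟨h1, h2⟩
    refine ⟨?_, fun x hx => ?_⟩
    · ext i j
      have := congrFun (congrFun h1 i) j
      simpa [conjTranspose_apply] using this
    · have hx' : (fun i => (x i : ℂ)) ≠ 0 := by
        intro h
        apply hx
        ext i
        simpa using congrFun h i
      have := h2 hx'
      have e : star (fun i => (x i : ℂ)) ⬝ᵥ (Y.map Complex.ofReal *ᵥ fun i => (x i : ℂ))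
          = ((star x ⬝ᵥ (Y *ᵥ x) : ℝ) : ℂ) := by
        simp [dotProduct, mulVec, Fin.sum_univ_two]
      rw [e] at this
      exact_mod_cast this
  · rintro ⟨h1, h2⟩
    refine ⟨?_, fun x hx => ?_⟩
    · ext i j
      have := congrFun (congrFun h1 i) j
      simpa [conjTranspose_apply] using this
    · have hs : Y 1 0 = Y 0 1 := by
        have := congrFun (congrFun h1 0) 1
        simpa [conjTranspose_apply] using this
      have e : star x ⬝ᵥ (Y.map Complex.ofReal *ᵥ x)
          = ((star (fun i => (x i).re) ⬝ᵥ (Y *ᵥ fun i => (x i).re)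
            + star (fun i => (x i).im) ⬝ᵥ (Y *ᵥ fun i => (x i).im) : ℝ) : ℂ) := by
        apply Complex.ext <;>
          simp [dotProduct, mulVec, Fin.sum_univ_two, hs] <;> ring
      rw [e]
      have hnn : ∀ y : Fin 2 → ℝ, 0 ≤ star y ⬝ᵥ (Y *ᵥ y) := fun y => by
        by_cases hy : y = 0
        · simp [hy]
        · exact (h2 hy).le
      have : 0 < star (fun i => (x i).re) ⬝ᵥ (Y *ᵥ fun i => (x i).re)
            + star (fun i => (x i).im) ⬝ᵥ (Y *ᵥ fun i => (x i).im) := by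
        by_cases hr : (fun i => (x i).re) = 0
        · have hi : (fun i => (x i).im) ≠ 0 := by
            intro hi
            apply hx
            ext i
            exact Complex.ext (congrFun hr i) (congrFun hi i)
          exact add_pos_of_nonneg_of_pos (hnn _) (h2 hi)
        · exact add_pos_of_pos_of_nonneg (h2 hr) (hnn _)
      exact_mod_cast this

lemma sub_conjTranspose {Z : Mat2 ℂ} (hZ : Zᵀ = Z) :
    Z - Zᴴ = (2 * Complex.I) • (Z.map Complex.im).map Complex.ofReal := by
  ext i j
  have h : Z j i = Z i j := congrFun (congrFun hZ i) j
  simp only [Matrix.sub_apply, conjTranspose_apply, Matrix.smul_apply, map_apply, smul_eq_mul, h]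
  apply Complex.ext <;> simp
  ring

/-- The block relations of a complexified real symplectic matrix. -/
lemma block_rel (M : Sp4) :
    let A := ((complexify M : (Mat4 ℂ)ˣ) : Mat4 ℂ).toBlocks₁₁
    let B := ((complexify M : (Mat4 ℂ)ˣ) : Mat4 ℂ).toBlocks₁₂
    let C := ((complexify M : (Mat4 ℂ)ˣ) : Mat4 ℂ).toBlocks₂₁
    let D := ((complexify M : (Mat4 ℂ)ˣ) : Mat4 ℂ).toBlocks₂₂
    Cᵀ * A = Aᵀ * C ∧ Dᵀ * B = Bᵀ * D ∧ Dᵀ * A - Bᵀ * C = 1 ∧ Aᵀ * D - Cᵀ * B = 1 ∧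
      Aᴴ = Aᵀ ∧ Bᴴ = Bᵀ ∧ Cᴴ = Cᵀ ∧ Dᴴ = Dᵀ := by
  intro A B C D
  have h := SymplecticGroup.mem_iff'.1 (SymplecticGroup.map_mem M.2 Complex.ofRealHom)
  have hM : (M : Mat4 ℝ).map Complex.ofRealHom = fromBlocks A B C D :=
    (fromBlocks_toBlocks _).symm
  rw [hM, J, fromBlocks_transpose, fromBlocks_multiply, fromBlocks_multiply,
    fromBlocks_inj] at h
  obtain ⟨h1, h2, h3, h4⟩ := h
  simp only [Matrix.mul_zero, Matrix.mul_one, Matrix.mul_neg, zero_add, add_zero,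
    Matrix.neg_mul] at h1 h2 h3 h4
  refine ⟨?_, ?_, ?_, ?_, ?_, ?_, ?_, ?_⟩
  · rw [← sub_eq_zero, ← h1]; abel
  · rw [← sub_eq_zero, ← h4]; abel
  · rw [← h3]; abel
  · rw [← neg_inj, ← h2]; abel
  all_goals
    ext i j
    simp [A, B, C, D, complexify_coe, toBlocks₁₁, toBlocks₁₂, toBlocks₂₁, toBlocks₂₂,
      conjTranspose_apply]

/-- For `Z` in the Siegel upper half space, `C Z + D` is invertible and `M⟨Z⟩` lies in the
Siegel upper half space. -/
lemma moebius_siegelH (M : Sp4) {Z : Mat2 ℂ} (hZ : Z ∈ siegelH) :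
    IsUnit (((complexify M : (Mat4 ℂ)ˣ) : Mat4 ℂ).toBlocks₂₁ * Z
      + ((complexify M : (Mat4 ℂ)ˣ) : Mat4 ℂ).toBlocks₂₂) ∧
    moebius (complexify M : (Mat4 ℂ)ˣ) Z ∈ siegelH := by
  obtain ⟨hs, hp⟩ := hZ
  obtain ⟨r1, r2, r3, r4, c1, c2, c3, c4⟩ := block_rel M
  unfold moebius
  generalize ((complexify M : (Mat4 ℂ)ˣ) : Mat4 ℂ).toBlocks₁₁ = A at *
  generalize ((complexify M : (Mat4 ℂ)ˣ) : Mat4 ℂ).toBlocks₁₂ = B at *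
  generalize ((complexify M : (Mat4 ℂ)ˣ) : Mat4 ℂ).toBlocks₂₁ = C at *
  generalize ((complexify M : (Mat4 ℂ)ˣ) : Mat4 ℂ).toBlocks₂₂ = D at *
  set U := A * Z + B with hU
  set V := C * Z + D with hV
  have pY := (posDef_map_ofReal_iff _).2 hp
  have key : Vᴴ * U - Uᴴ * V = (2 * Complex.I) • (Z.map Complex.im).map Complex.ofReal := by
    rw [← sub_conjTranspose hs, hU, hV]
    simp only [conjTranspose_add, conjTranspose_mul, c1, c2, c3, c4]
    have : (Zᴴ * Cᵀ + Dᵀ) * (A * Z + B) - (Zᴴ * Aᵀ + Bᵀ) * (C * Z + D)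
        = Zᴴ * (Cᵀ * A - Aᵀ * C) * Z - Zᴴ * (Aᵀ * D - Cᵀ * B) + (Dᵀ * A - Bᵀ * C) * Z
          + (Dᵀ * B - Bᵀ * D) := by noncomm_ring
    rw [this, r1, r2, r3, r4]
    simp
    abel
  have keyT : Uᵀ * V = Vᵀ * U := by
    rw [hU, hV]
    simp only [transpose_add, transpose_mul, hs]
    have : (Z * Aᵀ + Bᵀ) * (C * Z + D) - (Z * Cᵀ + Dᵀ) * (A * Z + B)
        = Z * (Aᵀ * C - Cᵀ * A) * Z + Z * (Aᵀ * D - Cᵀ * B) - (Dᵀ * A - Bᵀ * C) * Z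
          + (Bᵀ * D - Dᵀ * B) := by noncomm_ring
    rw [← sub_eq_zero, this, r1, r2, r3, r4]
    simp
  have hunit : IsUnit V := by
    rw [← mulVec_injective_iff_isUnit, ← coe_mulVecLin, injective_iff_map_eq_zero]
    intro v hv
    rw [mulVecLin_apply] at hv
    by_contra hne
    have h0 : star v ⬝ᵥ ((Vᴴ * U - Uᴴ * V) *ᵥ v) = 0 := by
      rw [sub_mulVec, dotProduct_sub, ← mulVec_mulVec, ← mulVec_mulVec, hv,
        dotProduct_mulVec, ← star_mulVec, hv]
      simp
    rw [key, smul_mulVec, dotProduct_smul] at h0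
    have := pY.dotProduct_mulVec_pos hne
    rw [smul_eq_mul, mul_eq_zero] at h0
    exact h0.elim (by simp) this.ne'
  refine ⟨hunit, ?_⟩
  have hdet : IsUnit V.det := (isUnit_iff_isUnit_det V).1 hunit
  have hWV : U * V⁻¹ * V = U := by rw [Matrix.mul_assoc, nonsing_inv_mul _ hdet, Matrix.mul_one]
  have hWs : (U * V⁻¹)ᵀ = U * V⁻¹ := by
    have hdT : IsUnit Vᵀ.det := by rwa [det_transpose]
    rw [transpose_mul, transpose_nonsing_inv]
    calc (Vᵀ)⁻¹ * Uᵀ = (Vᵀ)⁻¹ * (Uᵀ * V) * V⁻¹ := by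
          rw [Matrix.mul_assoc, mul_nonsing_inv_cancel_right _ _ hdet]
      _ = U * V⁻¹ := by rw [keyT, nonsing_inv_mul_cancel_left _ _ hdT]
  refine ⟨hWs, ?_⟩
  rw [← posDef_map_ofReal_iff, ← IsUnit.posDef_star_left_conjugate_iff hunit]
  have e : (2 * Complex.I) • (star V * ((U * V⁻¹).map Complex.im).map Complex.ofReal * V)
      = (2 * Complex.I) • (Z.map Complex.im).map Complex.ofReal := by
    rw [← key, ← Matrix.smul_mul, ← Matrix.mul_smul, ← sub_conjTranspose hWs,
      star_eq_conjTranspose, Matrix.mul_sub, Matrix.sub_mul, Matrix.mul_assoc, hWV,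
      ← conjTranspose_mul, hWV]
  have h2 : (2 * Complex.I) ≠ 0 := by simp
  rw [smul_right_injective _ h2 e]
  exact pY

/-- `(M N)⟨Z⟩ = M⟨N⟨Z⟩⟩` on the Siegel upper half space. -/
lemma moebius_mul (M N : Sp4) {Z : Mat2 ℂ} (hZ : Z ∈ siegelH) :
    moebius (complexify (M * N) : (Mat4 ℂ)ˣ) Z
      = moebius (complexify M : (Mat4 ℂ)ˣ) (moebius (complexify N : (Mat4 ℂ)ˣ) Z) := by
  have hV := (isUnit_iff_isUnit_det _).1 (moebius_siegelH N hZ).1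
  have hM := fromBlocks_toBlocks ((complexify M : (Mat4 ℂ)ˣ) : Mat4 ℂ)
  have hN := fromBlocks_toBlocks ((complexify N : (Mat4 ℂ)ˣ) : Mat4 ℂ)
  rw [map_mul, Units.val_mul]
  unfold moebius
  generalize ((complexify M : (Mat4 ℂ)ˣ) : Mat4 ℂ) = M' at *
  generalize ((complexify N : (Mat4 ℂ)ˣ) : Mat4 ℂ) = N' at *
  rw [← hM, ← hN, fromBlocks_multiply]
  simp only [toBlocks_fromBlocks₁₁, toBlocks_fromBlocks₁₂, toBlocks_fromBlocks₂₁,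
    toBlocks_fromBlocks₂₂]
  generalize M'.toBlocks₁₁ = A at *
  generalize M'.toBlocks₁₂ = B at *
  generalize M'.toBlocks₂₁ = C at *
  generalize M'.toBlocks₂₂ = D at *
  set U := N'.toBlocks₁₁ * Z + N'.toBlocks₁₂ with hU
  set V := N'.toBlocks₂₁ * Z + N'.toBlocks₂₂ with hVd
  have e : ∀ A B : Mat2 ℂ, (A * N'.toBlocks₁₁ + B * N'.toBlocks₂₁) * Z
      + (A * N'.toBlocks₁₂ + B * N'.toBlocks₂₂) = (A * (U * V⁻¹) + B) * V := by
    intro A B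
    have e1 : (A * (U * V⁻¹) + B) * V = A * U + B * V := by
      rw [Matrix.add_mul, Matrix.mul_assoc A, Matrix.mul_assoc U, nonsing_inv_mul _ hV,
        Matrix.mul_one]
    rw [e1, hU, hVd]
    noncomm_ring
  rw [e, e, Matrix.mul_inv_rev, Matrix.mul_assoc, ← Matrix.mul_assoc V, mul_nonsing_inv _ hV,
    Matrix.one_mul]

/-- `Q⟨Z⟩ = Z` means `q Z = Z q`. -/
lemma moebius_QMat (Z : Mat2 ℂ) :
    moebius (QMat ℂ) Z = Z ↔ qMat ℂ * Z = Z * qMat ℂ := by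
  have hq : qMat ℂ * qMat ℂ = 1 := by simp [qMat, one_fin_two]
  have hi : (qMat ℂ)⁻¹ = qMat ℂ := inv_eq_left_inv hq
  simp only [moebius, QMat, toBlocks_fromBlocks₁₁, toBlocks_fromBlocks₁₂,
    toBlocks_fromBlocks₂₁, toBlocks_fromBlocks₂₂, Matrix.zero_mul, zero_add, add_zero, hi]
  constructor
  · intro h
    nth_rewrite 2 [← h]
    rw [Matrix.mul_assoc _ (qMat ℂ), hq, Matrix.mul_one]
  · intro h
    rw [h, Matrix.mul_assoc, hq, Matrix.mul_one]

/-- The matrix `Q` as an element of `Sp(4, ℝ)`. -/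
def QSp : Sp4 := ⟨QMat ℝ, by
  rw [SymplecticGroup.mem_iff, J, QMat, fromBlocks_transpose, fromBlocks_multiply,
    fromBlocks_multiply]
  have hq : (qMat ℝ)ᵀ = qMat ℝ := by
    ext i j
    fin_cases i <;> fin_cases j <;> simp [qMat]
  have hq2 : qMat ℝ * qMat ℝ = 1 := by simp [qMat, one_fin_two]
  simp [hq, hq2]⟩

lemma complexify_QSp : ((complexify QSp : (Mat4 ℂ)ˣ) : Mat4 ℂ) = QMat ℂ := by
  rw [complexify_coe]
  simp only [QSp, QMat, fromBlocks_map]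
  congr 1 <;> ext i j <;> fin_cases i <;> fin_cases j <;> simp [qMat]

lemma moebius_one (Z : Mat2 ℂ) : moebius (complexify 1 : (Mat4 ℂ)ˣ) Z = Z := by
  rw [map_one, Units.val_one, ← fromBlocks_one]
  simp only [moebius, toBlocks_fromBlocks₁₁, toBlocks_fromBlocks₁₂, toBlocks_fromBlocks₂₁,
    toBlocks_fromBlocks₂₂]
  simp

lemma moebius_neg (M : Mat4 ℂ) (Z : Mat2 ℂ) : moebius (-M) Z = moebius M Z := by
  have h11 : (-M).toBlocks₁₁ = -M.toBlocks₁₁ := rfl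
  have h12 : (-M).toBlocks₁₂ = -M.toBlocks₁₂ := rfl
  have h21 : (-M).toBlocks₂₁ = -M.toBlocks₂₁ := rfl
  have h22 : (-M).toBlocks₂₂ = -M.toBlocks₂₂ := rfl
  have hi : ∀ V : Mat2 ℂ, (-V)⁻¹ = -V⁻¹ := fun V => by
    have hd : (-V).det = V.det := by simp [det_fin_two]
    rw [inv_def, inv_def, hd, adjugate_fin_two, adjugate_fin_two]
    ext i j
    fin_cases i <;> fin_cases j <;> simp
  have hn : ∀ A B : Mat2 ℂ, -A * Z + -B = -(A * Z + B) := fun A B => by noncomm_ring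
  rw [moebius, h11, h12, h21, h22, hn, hn, hi, Matrix.neg_mul, Matrix.mul_neg, neg_neg, moebius]

/-- The points `i (s, t; t, s)` with `s > |t|` lie in `Ĥ₂`. -/
lemma mem_hatH_of_real {s t : ℝ} (h : |t| < s) :
    Complex.I • (!![s, t; t, s] : Mat2 ℝ).map Complex.ofReal ∈ hatH := by
  obtain ⟨h1, h2⟩ := abs_lt.1 h
  refine ⟨⟨?_, ?_⟩, ?_⟩
  · ext i j
    fin_cases i <;> fin_cases j <;> simp
  · have e : (Complex.I • (!![s, t; t, s] : Mat2 ℝ).map Complex.ofReal).map Complex.im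
        = !![s, t; t, s] := by
      ext i j
      fin_cases i <;> fin_cases j <;> simp
    rw [e, posDef_iff_dotProduct_mulVec]
    refine ⟨?_, fun x hx => ?_⟩
    · ext i j
      fin_cases i <;> fin_cases j <;> simp [conjTranspose_apply]
    · have e2 : star x ⬝ᵥ (!![s, t; t, s] *ᵥ x)
          = (s + t) * ((x 0 + x 1) ^ 2 / 2) + (s - t) * ((x 0 - x 1) ^ 2 / 2) := by
        simp [dotProduct, mulVec, Fin.sum_univ_two]
        ring
      rw [e2]
      have p1 : 0 < s + t := by linarith
      have p2 : 0 < s - t := by linarith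
      by_cases h0 : x 0 + x 1 = 0
      · have h3 : x 0 - x 1 ≠ 0 := by
          intro h3
          apply hx
          ext i
          fin_cases i <;> simp <;> linarith
        positivity
      · positivity
  · rw [moebius_QMat]
    ext i j
    fin_cases i <;> fin_cases j <;> simp [qMat, Matrix.mul_apply, Fin.sum_univ_two]

/-- Real equations for the blocks of a symplectic matrix that fixes the point `i Y`. -/
lemma fix_rel (N : Sp4) (Y : Mat2 ℝ) (hY : Complex.I • Y.map Complex.ofReal ∈ hatH)
    (h : moebius (complexify N : (Mat4 ℂ)ˣ) (Complex.I • Y.map Complex.ofReal)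
      = Complex.I • Y.map Complex.ofReal) :
    (N : Mat4 ℝ).toBlocks₁₁ * Y = Y * (N : Mat4 ℝ).toBlocks₂₂ ∧
      (N : Mat4 ℝ).toBlocks₁₂ = -(Y * (N : Mat4 ℝ).toBlocks₂₁ * Y) := by
  have hV := (isUnit_iff_isUnit_det _).1 (moebius_siegelH N hY.1).1
  have h' := congrArg (· * (((complexify N : (Mat4 ℂ)ˣ) : Mat4 ℂ).toBlocks₂₁
    * (Complex.I • Y.map Complex.ofReal) + ((complexify N : (Mat4 ℂ)ˣ) : Mat4 ℂ).toBlocks₂₂)) h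
  simp only [moebius] at h'
  rw [Matrix.mul_assoc, nonsing_inv_mul _ hV, Matrix.mul_one] at h'
  have e11 : ((complexify N : (Mat4 ℂ)ˣ) : Mat4 ℂ).toBlocks₁₁
    = (N : Mat4 ℝ).toBlocks₁₁.map Complex.ofReal := rfl
  have e12 : ((complexify N : (Mat4 ℂ)ˣ) : Mat4 ℂ).toBlocks₁₂
    = (N : Mat4 ℝ).toBlocks₁₂.map Complex.ofReal := rfl
  have e21 : ((complexify N : (Mat4 ℂ)ˣ) : Mat4 ℂ).toBlocks₂₁
    = (N : Mat4 ℝ).toBlocks₂₁.map Complex.ofReal := rfl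
  have e22 : ((complexify N : (Mat4 ℂ)ˣ) : Mat4 ℂ).toBlocks₂₂
    = (N : Mat4 ℝ).toBlocks₂₂.map Complex.ofReal := rfl
  rw [e11, e12, e21, e22] at h'
  constructor
  · ext i j
    have := congrArg Complex.im (congrFun (congrFun h' i) j)
    simpa [Matrix.mul_apply, Fin.sum_univ_two] using this
  · ext i j
    have := congrArg Complex.re (congrFun (congrFun h' i) j)
    simp [Matrix.mul_apply, Fin.sum_univ_two] at this ⊢
    linarith

/-- A symplectic involution that fixes `Ĥ₂` pointwise is `±I` or `±Q`. -/
lemma eq_of_fix (N : Sp4) (h2 : N * N = 1)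
    (h : ∀ Z ∈ hatH, moebius (complexify N : (Mat4 ℂ)ˣ) Z = Z) :
    (N : Mat4 ℝ) = 1 ∨ (N : Mat4 ℝ) = -1 ∨ (N : Mat4 ℝ) = QMat ℝ ∨ (N : Mat4 ℝ) = -QMat ℝ := by
  have m1 := mem_hatH_of_real (s := 1) (t := 0) (by norm_num)
  have m2 := mem_hatH_of_real (s := 2) (t := 0) (by norm_num)
  have m3 := mem_hatH_of_real (s := 2) (t := 1) (by norm_num)
  obtain ⟨r1, r1'⟩ := fix_rel N _ m1 (h _ m1)
  obtain ⟨-, r2'⟩ := fix_rel N _ m2 (h _ m2)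
  obtain ⟨r3, -⟩ := fix_rel N _ m3 (h _ m3)
  have hN2 : (N : Mat4 ℝ) * (N : Mat4 ℝ) = 1 := congrArg Subtype.val h2
  have hb := fromBlocks_toBlocks (N : Mat4 ℝ)
  generalize (N : Mat4 ℝ) = N' at *
  generalize N'.toBlocks₁₁ = A at *
  generalize N'.toBlocks₁₂ = B at *
  generalize N'.toBlocks₂₁ = C at *
  generalize N'.toBlocks₂₂ = D at *
  have hone : (!![1, 0; 0, 1] : Mat2 ℝ) = 1 := one_fin_two.symm
  rw [hone, Matrix.mul_one, Matrix.one_mul] at r1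
  rw [hone, Matrix.mul_one, Matrix.one_mul] at r1'
  subst r1
  have hC : C = 0 := by
    rw [r1'] at r2'
    ext i j
    have := congrFun (congrFun r2' i) j
    rw [Matrix.neg_apply, Matrix.neg_apply, Matrix.mul_apply, Fin.sum_univ_two,
      Matrix.mul_apply, Matrix.mul_apply, Fin.sum_univ_two, Fin.sum_univ_two] at this
    fin_cases i <;> fin_cases j <;> simp at this ⊢ <;> linarith
  subst hC
  rw [neg_zero] at r1'
  subst r1'
  subst hb
  rw [fromBlocks_multiply, ← fromBlocks_one, fromBlocks_inj] at hN2
  have hA2 : A * A = 1 := by simpa using hN2.1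
  have q1 := congrFun (congrFun r3 0) 0
  have q2 := congrFun (congrFun r3 0) 1
  have s1 := congrFun (congrFun hA2 0) 0
  have s2 := congrFun (congrFun hA2 0) 1
  simp [Matrix.mul_apply, Fin.sum_univ_two] at q1 q2 s1 s2
  have t1 : A 1 0 = A 0 1 := by linarith
  have t2 : A 1 1 = A 0 0 := by linarith
  rw [t1] at s1
  rw [t2] at s2
  have t3 : A 0 0 = 0 ∨ A 0 1 = 0 := by
    rw [← mul_eq_zero]; linarith
  have hA : A = !![A 0 0, A 0 1; A 0 1, A 0 0] := by
    ext i j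
    fin_cases i <;> fin_cases j <;> simp [t1, t2]
  rcases t3 with t | t <;> rw [t] at s1 hA
  · have : A 0 1 = 1 ∨ A 0 1 = -1 := by
      rw [← mul_self_eq_one_iff]; linarith
    rcases this with u | u <;> rw [u] at hA <;> rw [hA]
    · right; right; left
      rfl
    · right; right; right
      rw [QMat, fromBlocks_neg]
      simp [qMat]
  · have : A 0 0 = 1 ∨ A 0 0 = -1 := by
      rw [← mul_self_eq_one_iff]; linarith
    rcases this with u | u <;> rw [u] at hA <;> rw [hA]
    · left
      rw [← fromBlocks_one, one_fin_two]
    · right; left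
      rw [← fromBlocks_one, fromBlocks_neg]
      simp [one_fin_two]

/-- `M` maps `Ĥ₂` into itself if and only if `Q M = ± M Q`. -/
lemma maps_hatH_iff (M : Sp4) :
    (∀ Z ∈ hatH, moebius (complexify M : (Mat4 ℂ)ˣ) Z ∈ hatH) ↔
      QMat ℝ * (M : Mat4 ℝ) = (M : Mat4 ℝ) * QMat ℝ ∨
      QMat ℝ * (M : Mat4 ℝ) = -((M : Mat4 ℝ) * QMat ℝ) := by
  have hQ2 : QSp * QSp = 1 := by
    apply Subtype.ext
    change QMat ℝ * QMat ℝ = 1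
    rw [QMat, fromBlocks_multiply, ← fromBlocks_one]
    simp [qMat, one_fin_two]
  have h1 : (M : Mat4 ℝ) * (M⁻¹ : Sp4) = 1 := congrArg Subtype.val (mul_inv_cancel M)
  constructor
  · intro hM
    have hN : ∀ Z ∈ hatH, moebius (complexify (M⁻¹ * QSp * M) : (Mat4 ℂ)ˣ) Z = Z := by
      intro Z hZ
      have hMZ := hM Z hZ
      rw [moebius_mul _ _ hZ.1, moebius_mul _ _ hMZ.1, complexify_QSp, hMZ.2,
        ← moebius_mul _ _ hZ.1, inv_mul_cancel, moebius_one]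
    have hNN : M⁻¹ * QSp * M * (M⁻¹ * QSp * M) = 1 := by
      have : M⁻¹ * QSp * M * (M⁻¹ * QSp * M) = M⁻¹ * (QSp * QSp) * M := by group
      rw [this, hQ2, mul_one, inv_mul_cancel]
    have hMN : (M : Mat4 ℝ) * ((M⁻¹ * QSp * M : Sp4) : Mat4 ℝ) = QMat ℝ * M := by
      have : M * (M⁻¹ * QSp * M) = QSp * M := by group
      exact congrArg Subtype.val this
    have hne : ∀ c : ℝ, QMat ℝ * (M : Mat4 ℝ) ≠ c • (M : Mat4 ℝ) := by
      intro c hc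
      have := congrArg (· * ((M⁻¹ : Sp4) : Mat4 ℝ)) hc
      simp only [Matrix.smul_mul, Matrix.mul_assoc, h1, Matrix.mul_one] at this
      have := congrFun (congrFun this (Sum.inl 0)) (Sum.inl 1)
      simp [QMat, qMat] at this
    rcases eq_of_fix _ hNN hN with h | h | h | h <;> rw [h] at hMN
    · exact absurd (by rw [← hMN]; simp) (hne 1)
    · exact absurd (by rw [← hMN]; simp) (hne (-1))
    · exact Or.inl hMN.symm
    · exact Or.inr (by rw [← hMN]; simp)
  · intro hM Z hZ
    have hW := (moebius_siegelH M hZ.1).2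
    refine ⟨hW, ?_⟩
    have e1 : moebius (complexify (M * QSp) : (Mat4 ℂ)ˣ) Z
        = moebius (complexify M : (Mat4 ℂ)ˣ) Z := by
      rw [moebius_mul _ _ hZ.1, complexify_QSp, hZ.2]
    have e2 : moebius (complexify (QSp * M) : (Mat4 ℂ)ˣ) Z
        = moebius (QMat ℂ) (moebius (complexify M : (Mat4 ℂ)ˣ) Z) := by
      rw [moebius_mul _ _ hZ.1, complexify_QSp]
    rw [← e2, ← e1]
    rcases hM with hM | hM
    · rw [show QSp * M = M * QSp from Subtype.ext hM]
    · have : ((complexify (QSp * M) : (Mat4 ℂ)ˣ) : Mat4 ℂ)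
          = -((complexify (M * QSp) : (Mat4 ℂ)ˣ) : Mat4 ℂ) := by
        rw [complexify_coe, complexify_coe]
        have h3 : ((QSp * M : Sp4) : Mat4 ℝ) = -((M * QSp : Sp4) : Mat4 ℝ) := hM
        rw [h3]
        ext i j
        simp
      rw [this, moebius_neg]

/-- The motion group `Ω̂₂` of `Ĥ₂`: the real symplectic matrices that map `Ĥ₂` into itself. -/
def hatOmega : Subgroup Sp4 where
  carrier := {M | ∀ Z ∈ hatH, moebius (complexify M : (Mat4 ℂ)ˣ) Z ∈ hatH}
  mul_mem' := by
    intro M N hM hN Z hZ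
    rw [moebius_mul M N hZ.1]
    exact hM _ (hN _ hZ)
  one_mem' := by
    intro Z hZ
    rwa [moebius_one]
  inv_mem' := by
    intro M hM
    rw [Set.mem_ofPred_eq, maps_hatH_iff] at hM ⊢
    have h1 : (M : Mat4 ℝ) * (M⁻¹ : Sp4) = 1 := congrArg Subtype.val (mul_inv_cancel M)
    have h2 : ((M⁻¹ : Sp4) : Mat4 ℝ) * M = 1 := congrArg Subtype.val (inv_mul_cancel M)
    have e : QMat ℝ * ((M⁻¹ : Sp4) : Mat4 ℝ)
        = (M⁻¹ : Sp4) * ((M : Mat4 ℝ) * QMat ℝ) * (M⁻¹ : Sp4) := by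
      rw [← Matrix.mul_assoc, h2, Matrix.one_mul]
    have e' : ((M⁻¹ : Sp4) : Mat4 ℝ) * (QMat ℝ * M) * (M⁻¹ : Sp4)
        = ((M⁻¹ : Sp4) : Mat4 ℝ) * QMat ℝ := by
      rw [Matrix.mul_assoc, Matrix.mul_assoc, h1, Matrix.mul_one]
    rcases hM with hM | hM
    · left
      rw [e, ← hM, e']
    · right
      rw [e, ← neg_eq_iff_eq_neg.2 hM, ← e']
      simp

/-- The matrix `L` with block rows `(i I, i I)` and `(-I, I)`, whose action is the Cayley
transform `Z ↦ i (I + Z) (I - Z)⁻¹` from `Ê₂` onto `Ĥ₂`. -/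
def cayleyL : (Mat4 ℂ)ˣ where
  val := fromBlocks (Complex.I • 1) (Complex.I • 1) (-1) 1
  inv := (1 / (2 * Complex.I)) • fromBlocks 1 (-(Complex.I • 1)) 1 (Complex.I • 1)
  val_inv := by
    rw [Matrix.mul_smul, fromBlocks_multiply, fromBlocks_smul, ← fromBlocks_one]
    congr 1 <;> ext i j <;> fin_cases i <;> fin_cases j <;> simp <;> field_simp <;> norm_num
  inv_val := by
    rw [Matrix.smul_mul, fromBlocks_multiply, fromBlocks_smul, ← fromBlocks_one]
    congr 1 <;> ext i j <;> fin_cases i <;> fin_cases j <;> simp <;> field_simp <;> norm_num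

/-- The homomorphism `M ↦ L⁻¹ M L`. -/
def conjL : Sp4 →* (Mat4 ℂ)ˣ := (MulAut.conj cayleyL⁻¹).toMonoidHom.comp complexify

/-- The motion group `L⁻¹ Ω̂₂ L` of `Ê₂`. -/
def hatOmegaE : Subgroup (Mat4 ℂ)ˣ := hatOmega.map conjL

/-- For a group `G` of matrices (given by a homomorphism `φ` to matrices), the subgroup of its
elements among `I, -I, Q, -Q`. -/
def fourGroup {G : Type} [Group G] {R : Type} [CommRing R] (φ : G →* Mat4 R) : Subgroup G where
  carrier := {g | φ g = 1 ∨ φ g = -1 ∨ φ g = QMat R ∨ φ g = -QMat R}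
  mul_mem' := by
    have hQ : QMat R * QMat R = 1 := by
      rw [QMat, fromBlocks_multiply, ← fromBlocks_one]
      simp [qMat, one_fin_two]
    rintro a b ha hb
    rw [Set.mem_ofPred_eq] at ha hb ⊢
    rw [map_mul]
    rcases ha with ha | ha | ha | ha <;> rcases hb with hb | hb | hb | hb <;>
      simp [ha, hb, hQ]
  one_mem' := by simp
  inv_mem' := by
    have hQ : QMat R * QMat R = 1 := by
      rw [QMat, fromBlocks_multiply, ← fromBlocks_one]
      simp [qMat, one_fin_two]
    intro a ha
    rw [Set.mem_ofPred_eq] at ha ⊢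
    have h2 : φ a * φ a = 1 := by rcases ha with ha | ha | ha | ha <;> simp [ha, hQ]
    have : φ a⁻¹ = φ a := by
      rw [← mul_one (φ a⁻¹), ← h2, ← mul_assoc, ← map_mul, inv_mul_cancel, map_one, one_mul]
    rwa [this]

/-- The subgroup `{±I, ±Q}` of `Ω̂₂`. -/
def fourH : Subgroup hatOmega :=
  fourGroup ((symplecticGroup (Fin 2) ℝ).subtype.comp hatOmega.subtype)

/-- The subgroup `{±I, ±Q}` of `L⁻¹ Ω̂₂ L`. -/
def fourE : Subgroup hatOmegaE :=
  fourGroup ((Units.coeHom (Mat4 ℂ)).comp hatOmegaE.subtype)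

/-- The matrix with rows `(a, b)` and `(b, a)`, for `w = (a, b)`. -/
def bisym (w : ℂ × ℂ) : Mat2 ℂ := !![w.1, w.2; w.2, w.1]

/-- A self-map of a set `S` of matrices `(a, b; b, a)` is holomorphic if it is holomorphic in the
coordinates `(a, b)`, which identify `S` with a domain in `ℂ × ℂ`. -/
def IsHolo (S : Set (Mat2 ℂ)) (f : S → S) : Prop :=
  ∃ F : ℂ × ℂ → ℂ × ℂ, DifferentiableOn ℂ F {w | bisym w ∈ S} ∧
    ∀ (w : ℂ × ℂ) (hw : bisym w ∈ S), (f ⟨bisym w, hw⟩ : Mat2 ℂ) = bisym (F w)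

lemma IsHolo.comp {S : Set (Mat2 ℂ)} {f g : S → S} (hf : IsHolo S f) (hg : IsHolo S g) :
    IsHolo S (f ∘ g) := by
  obtain ⟨F, hF, hF'⟩ := hf
  obtain ⟨G, hG, hG'⟩ := hg
  have hm : ∀ w (hw : bisym w ∈ S), bisym (G w) ∈ S := fun w hw => hG' w hw ▸ (g _).2
  refine ⟨F ∘ G, hF.comp hG hm, fun w hw => ?_⟩
  have : g ⟨bisym w, hw⟩ = ⟨bisym (G w), hm w hw⟩ := Subtype.ext (hG' w hw)
  rw [Function.comp_apply, this, hF']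
  rfl

/-- The group, under composition, of the biholomorphic maps from `S` onto itself. -/
def biholGroup (S : Set (Mat2 ℂ)) : Subgroup (Equiv.Perm S) where
  carrier := {f | IsHolo S f ∧ IsHolo S f.symm}
  mul_mem' := fun ha hb => ⟨ha.1.comp hb.1, hb.2.comp ha.2⟩
  one_mem' := ⟨⟨id, differentiableOn_id, fun _ _ => rfl⟩, ⟨id, differentiableOn_id, fun _ _ => rfl⟩⟩
  inv_mem' := fun h => ⟨h.2, h.1⟩

end

end SiegelHat

open SiegelHat

/-!
The matrix `bidiag z w` is the matrix `(a, b; b, a)` with eigenvalues `z = a + b` and `w = a - b`.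
Matrices of this form are multiplied and inverted eigenvalue by eigenvalue, so that in the
coordinates `(z, w)` the domain `Ê₂` is the bidisc, `Ĥ₂` is the product of two upper half planes,
and `L` acts on each factor as the Cayley transform. On these products `Ω̂₂` contains
`SL(2, ℝ) × SL(2, ℝ)` (`pairSp`) and the exchange of the factors (`swapSp`).

The core is that these matrices induce all automorphisms (`actH_surjective`). As `SL(2, ℝ)` is
transitive on the upper half plane, it is enough to consider automorphisms that fix `i I`, and the
Cayley transform changes these into automorphisms of the bidisc that fix the origin. By the Schwarz
lemma for the sup norm, applied to such a map and to its inverse, the derivative at the origin is a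
linear isometry of the sup norm, hence monomial with unimodular coefficients
(`monomial_of_isometry`). The equality case of the Schwarz lemma on complex lines, followed by the
identity theorem in one variable, shows that the map is equal to its derivative
(`eq_mul_fst_of_fderiv`, `bidisc_fixing_zero`). So it rotates the two eigenvalues and possibly
exchanges them, and a rotation of the disc comes from a rotation in `SL(2, ℝ)` (`exists_rotation`).

An element of `Sp(4, ℝ)` that fixes `Ĥ₂` pointwise is an involution (`mul_self_of_fix`), so that it
is one of `±I, ±Q`; hence `{±I, ±Q}` is the kernel of the action (`fourH_eq_ker`), and the first
isomorphism theorem gives the quotient. The statements about `Ê₂` follow by conjugation with `L`,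
which commutes with `Q`.
-/

/-! ### Automorphisms of the bidisc that fix the origin -/

open Metric Set in
/-- A function from the bidisc to the disc that vanishes at the origin and whose linear part there
is `(z, w) ↦ α z` with `|α| = 1` is equal to its linear part. On the lines `ζ ↦ (ζ, ζ y)`,
`|y| ≤ 1`, this is the equality case of the Schwarz lemma; these lines cover the points with `|w| ≤ |z|`, and
the identity theorem in `z` gives the others. -/
lemma eq_mul_fst_of_fderiv {φ : ℂ × ℂ → ℂ} (hd : DifferentiableOn ℂ φ (ball 0 1))
    (hm : MapsTo φ (ball 0 1) (ball 0 1)) (h0 : φ 0 = 0) {α : ℂ} (hα : ‖α‖ = 1)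
    (hα1 : fderiv ℂ φ 0 (1, 0) = α) (hα2 : fderiv ℂ φ 0 (0, 1) = 0) :
    ∀ p ∈ ball (0 : ℂ × ℂ) 1, φ p = α * p.1 := by
  have mem_bidisc : ∀ p : ℂ × ℂ, p ∈ ball (0 : ℂ × ℂ) 1 ↔ ‖p.1‖ < 1 ∧ ‖p.2‖ < 1 := fun p => by
    rw [mem_ball_zero_iff, Prod.norm_def, max_lt_iff]
  have line : ∀ y : ℂ, ‖y‖ ≤ 1 → ∀ ζ : ℂ, ‖ζ‖ < 1 → φ (ζ, ζ * y) = α * ζ := by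
    intro y hy ζ hζ
    let l : ℂ →L[ℂ] ℂ × ℂ := (ContinuousLinearMap.id ℂ ℂ).prod
      (ContinuousLinearMap.mulLeftRight ℂ ℂ 1 y)
    have hl : ∀ ζ, l ζ = (ζ, ζ * y) := fun ζ => by simp [l]
    have ml : MapsTo l (ball 0 1) (ball 0 1) := by
      intro ζ hζ
      rw [mem_ball_zero_iff] at hζ
      rw [hl, mem_bidisc]
      refine ⟨hζ, ?_⟩
      rw [norm_mul]
      exact (mul_le_of_le_one_right (norm_nonneg _) hy).trans_lt hζ
    have hder : HasDerivAt (φ ∘ l) α 0 := by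
      have h1 : HasFDerivAt φ (fderiv ℂ φ 0) (l 0) := by
        rw [map_zero]
        exact (hd.differentiableAt (ball_mem_nhds _ one_pos)).hasFDerivAt
      have h2 := (h1.comp (0 : ℂ) l.hasFDerivAt).hasDerivAt
      have h3 : fderiv ℂ φ 0 (l 1) = α := by
        have : l 1 = (1, 0) + y • ((0, 1) : ℂ × ℂ) := by simp [hl]
        rw [this, map_add, map_smul, hα1, hα2, smul_zero, add_zero]
      rwa [ContinuousLinearMap.comp_apply, h3] at h2
    have hz : (φ ∘ l) 0 = 0 := by simp [h0]
    have hs := Complex.affine_of_mapsTo_ball_of_norm_dslope_eq_div (f := φ ∘ l) (c := 0) (R₁ := 1)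
      (R₂ := 1) (z₀ := 0) (hd.comp l.differentiable.differentiableOn ml)
      (by rw [hz]; exact (hm.comp ml).mono_right ball_subset_closedBall)
      (mem_ball_self one_pos) (by rw [dslope_same, hder.deriv, hα, div_one])
    have := hs (mem_ball_zero_iff.2 hζ)
    have h00 : φ (0, 0) = 0 := h0
    simpa [hl, h00, dslope_same, hder.deriv, mul_comm ζ α] using this
  have cone : ∀ z w : ℂ, ‖z‖ < 1 → ‖w‖ < ‖z‖ → φ (z, w) = α * z := by
    intro z w hz hw
    have hz0 : z ≠ 0 := norm_pos_iff.1 ((norm_nonneg w).trans_lt hw)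
    have := line (w / z) (by rw [norm_div]; exact div_le_one_of_le₀ hw.le (norm_nonneg _)) z hz
    rwa [mul_div_cancel₀ _ hz0] at this
  rintro ⟨z, w⟩ hp
  obtain ⟨hz, hw⟩ := (mem_bidisc _).1 hp
  simp only at hz hw ⊢
  have ha : AnalyticOnNhd ℂ (fun z => φ (z, w)) (ball 0 1) := by
    refine DifferentiableOn.analyticOnNhd (hd.comp (by fun_prop) fun ζ hζ => ?_) isOpen_ball
    exact (mem_bidisc _).2 ⟨mem_ball_zero_iff.1 hζ, hw⟩
  have hb : AnalyticOnNhd ℂ (fun z => α * z) (ball 0 1) :=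
    DifferentiableOn.analyticOnNhd (by fun_prop) isOpen_ball
  -- a point of the annulus `‖w‖ < ‖z‖ < 1`
  have hr0 : 0 ≤ (1 + ‖w‖) / 2 := by positivity
  have hn : ‖(((1 + ‖w‖) / 2 : ℝ) : ℂ)‖ = (1 + ‖w‖) / 2 := by
    rw [Complex.norm_real, Real.norm_of_nonneg hr0]
  refine ha.eqOn_of_preconnected_of_eventuallyEq hb (convex_ball _ _).isPreconnected
    (z₀ := (((1 + ‖w‖) / 2 : ℝ) : ℂ)) ?_ ?_ (mem_ball_zero_iff.2 hz)
  · rw [mem_ball_zero_iff, hn]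
    linarith
  · have e1 := (continuous_norm (E := ℂ)).continuousAt.eventually_lt_const
      (show ‖(((1 + ‖w‖) / 2 : ℝ) : ℂ)‖ < 1 by rw [hn]; linarith)
    have e2 := (continuous_norm (E := ℂ)).continuousAt.eventually_const_lt
      (show ‖w‖ < ‖(((1 + ‖w‖) / 2 : ℝ) : ℂ)‖ by rw [hn]; linarith)
    filter_upwards [e1, e2] with ζ h1 h2 using cone ζ w h1 h2

/-- A linear isometry `(z, w) ↦ (a z + b w, c z + d w)` of `ℂ²` with the sup norm is monomial with
unimodular coefficients. -/
lemma monomial_of_isometry {A : ℂ × ℂ →L[ℂ] ℂ × ℂ} (hA : ∀ p, ‖A p‖ = ‖p‖) :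
    (‖(A (1, 0)).1‖ = 1 ∧ (A (0, 1)).1 = 0 ∧ (A (1, 0)).2 = 0 ∧ ‖(A (0, 1)).2‖ = 1) ∨
    ((A (1, 0)).1 = 0 ∧ ‖(A (0, 1)).1‖ = 1 ∧ ‖(A (1, 0)).2‖ = 1 ∧ (A (0, 1)).2 = 0) := by
  -- the unimodular `x`, `y` with `a x = ‖a‖` and `b y = ‖b‖` give the value `‖a‖ + ‖b‖`
  have key : ∀ a b : ℂ, (∀ x y : ℂ, ‖x‖ = 1 → ‖y‖ = 1 → ‖a * x + b * y‖ ≤ 1) → ‖a‖ + ‖b‖ ≤ 1 := by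
    intro a b h
    have pol : ∀ a : ℂ, ∃ x : ℂ, ‖x‖ = 1 ∧ a * x = ‖a‖ := by
      intro a
      by_cases ha : a = 0
      · exact ⟨1, by simp [ha]⟩
      · have hn : (‖a‖ : ℂ) ≠ 0 := by simpa using ha
        exact ⟨‖a‖ / a, by simp [ha], by field_simp⟩
    obtain ⟨x, hx, hx'⟩ := pol a
    obtain ⟨y, hy, hy'⟩ := pol b
    have := h x y hx hy
    rwa [hx', hy', ← Complex.ofReal_add, Complex.norm_real,
      Real.norm_of_nonneg (by positivity)] at this
  have row : ∀ x y : ℂ, A (x, y) = x • A (1, 0) + y • A (0, 1) := by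
    intro x y
    rw [← map_smul, ← map_smul, ← map_add]
    simp
  have nrm : ∀ x y : ℂ, ‖x‖ = 1 → ‖y‖ = 1 → ‖A (x, y)‖ ≤ 1 := by
    intro x y hx hy
    rw [hA, Prod.norm_def, hx, hy, max_self]
  have r1 : ‖(A (1, 0)).1‖ + ‖(A (0, 1)).1‖ ≤ 1 := by
    refine key _ _ fun x y hx hy => ?_
    have := (norm_fst_le _).trans (nrm x y hx hy)
    rw [row] at this
    simpa [mul_comm] using this
  have r2 : ‖(A (1, 0)).2‖ + ‖(A (0, 1)).2‖ ≤ 1 := by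
    refine key _ _ fun x y hx hy => ?_
    have := (norm_snd_le _).trans (nrm x y hx hy)
    rw [row] at this
    simpa [mul_comm] using this
  have c1 : max ‖(A (1, 0)).1‖ ‖(A (1, 0)).2‖ = 1 := by
    have := hA (1, 0)
    simpa [Prod.norm_def] using this
  have c2 : max ‖(A (0, 1)).1‖ ‖(A (0, 1)).2‖ = 1 := by
    have := hA (0, 1)
    simpa [Prod.norm_def] using this
  simp only [← norm_eq_zero (E := ℂ)]
  have n1 := norm_nonneg (A (1, 0)).1
  have n2 := norm_nonneg (A (1, 0)).2
  have n3 := norm_nonneg (A (0, 1)).1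
  have n4 := norm_nonneg (A (0, 1)).2
  rcases max_choice ‖(A (1, 0)).1‖ ‖(A (1, 0)).2‖ with h | h <;>
  rcases max_choice ‖(A (0, 1)).1‖ ‖(A (0, 1)).2‖ with h' | h' <;>
  rw [h] at c1 <;> rw [h'] at c2
  · linarith
  · left; refine ⟨c1, ?_, ?_, c2⟩ <;> linarith
  · right; refine ⟨?_, c2, c1, ?_⟩ <;> linarith
  · linarith

open Metric Set in
/-- A biholomorphic self-map of the bidisc that fixes the origin is a pair of rotations, possibly
followed by the exchange of the two coordinates. (The bidisc is the unit ball of `ℂ × ℂ`, which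
carries the sup norm.) -/
lemma bidisc_fixing_zero {F G : ℂ × ℂ → ℂ × ℂ} (hF : DifferentiableOn ℂ F (ball 0 1))
    (hG : DifferentiableOn ℂ G (ball 0 1)) (mF : MapsTo F (ball 0 1) (ball 0 1))
    (mG : MapsTo G (ball 0 1) (ball 0 1)) (hGF : ∀ p ∈ ball (0 : ℂ × ℂ) 1, G (F p) = p)
    (F0 : F 0 = 0) :
    ∃ α β : ℂ, ‖α‖ = 1 ∧ ‖β‖ = 1 ∧
      ((∀ p ∈ ball (0 : ℂ × ℂ) 1, F p = (α * p.1, β * p.2)) ∨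
       (∀ p ∈ ball (0 : ℂ × ℂ) 1, F p = (α * p.2, β * p.1))) := by
  have hb : ball (0 : ℂ × ℂ) 1 ∈ nhds 0 := ball_mem_nhds _ one_pos
  have G0 : G 0 = 0 := by simpa [F0] using hGF 0 (mem_ball_self one_pos)
  have dF := (hF.differentiableAt hb).hasFDerivAt
  have dG := (hG.differentiableAt hb).hasFDerivAt
  have nF := Complex.norm_fderiv_le_one_of_mapsTo_ball hF
    (by rw [F0]; exact mF.mono_right ball_subset_closedBall) one_pos
  have nG := Complex.norm_fderiv_le_one_of_mapsTo_ball hG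
    (by rw [G0]; exact mG.mono_right ball_subset_closedBall) one_pos
  have hcomp : (fderiv ℂ G 0).comp (fderiv ℂ F 0) = ContinuousLinearMap.id ℂ (ℂ × ℂ) := by
    have h1 : HasFDerivAt (G ∘ F) ((fderiv ℂ G 0).comp (fderiv ℂ F 0)) 0 :=
      HasFDerivAt.comp 0 (by rwa [F0]) dF
    refine h1.unique ((hasFDerivAt_id (0 : ℂ × ℂ)).congr_of_eventuallyEq ?_)
    filter_upwards [hb] with p hp using hGF p hp
  have iso : ∀ p, ‖fderiv ℂ F 0 p‖ = ‖p‖ := by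
    intro p
    refine le_antisymm ?_ ?_
    · simpa using (fderiv ℂ F 0).le_of_opNorm_le nF p
    · have := (fderiv ℂ G 0).le_of_opNorm_le nG (fderiv ℂ F 0 p)
      rwa [← ContinuousLinearMap.comp_apply, hcomp, one_mul] at this
  have d1 : ∀ v, fderiv ℂ (fun p => (F p).1) 0 v = (fderiv ℂ F 0 v).1 := fun v => by
    rw [(dF.fst).fderiv]; rfl
  have d2 : ∀ v, fderiv ℂ (fun p => (F p).2) 0 v = (fderiv ℂ F 0 v).2 := fun v => by
    rw [(dF.snd).fderiv]; rfl
  have hF1 : DifferentiableOn ℂ (fun p => (F p).1) (ball 0 1) := hF.fst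
  have hF2 : DifferentiableOn ℂ (fun p => (F p).2) (ball 0 1) := hF.snd
  have m1 : MapsTo (fun p => (F p).1) (ball 0 1) (ball 0 1) := fun p hp =>
    mem_ball_zero_iff.2 ((norm_fst_le _).trans_lt (mem_ball_zero_iff.1 (mF hp)))
  have m2 : MapsTo (fun p => (F p).2) (ball 0 1) (ball 0 1) := fun p hp =>
    mem_ball_zero_iff.2 ((norm_snd_le _).trans_lt (mem_ball_zero_iff.1 (mF hp)))
  -- the same statement for functions whose linear part only involves the second coordinate
  have swap : ∀ {φ : ℂ × ℂ → ℂ}, DifferentiableOn ℂ φ (ball 0 1) → MapsTo φ (ball 0 1) (ball 0 1) →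
      φ 0 = 0 → fderiv ℂ φ 0 (1, 0) = 0 → ‖fderiv ℂ φ 0 (0, 1)‖ = 1 →
      ∀ p ∈ ball (0 : ℂ × ℂ) 1, φ p = fderiv ℂ φ 0 (0, 1) * p.2 := by
    intro φ hd hm h0 h1 h2 p hp
    let s : (ℂ × ℂ) ≃L[ℂ] (ℂ × ℂ) := ContinuousLinearEquiv.prodComm ℂ ℂ ℂ
    have hs : ∀ p, s p = p.swap := fun _ => rfl
    have ms : MapsTo s (ball 0 1) (ball 0 1) := fun p hp => by
      rw [mem_ball_zero_iff, Prod.norm_def] at hp ⊢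
      rwa [hs, Prod.fst_swap, Prod.snd_swap, max_comm]
    have hfd : ∀ v, fderiv ℂ (φ ∘ s) 0 v = fderiv ℂ φ 0 v.swap := fun v => by
      have h3 : HasFDerivAt φ (fderiv ℂ φ 0) (s 0) := by
        rw [map_zero]
        exact (hd.differentiableAt hb).hasFDerivAt
      rw [(h3.comp (0 : ℂ × ℂ) s.hasFDerivAt).fderiv]
      rfl
    have := eq_mul_fst_of_fderiv (φ := φ ∘ s) (hd.comp s.differentiable.differentiableOn ms)
      (hm.comp ms) (by rw [Function.comp_apply, map_zero, h0]) h2 (hfd _)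
      ((hfd _).trans h1) _ (ms hp)
    simpa [hs] using this
  rcases monomial_of_isometry iso with ⟨h11, h12, h21, h22⟩ | ⟨h11, h12, h21, h22⟩
  · refine ⟨_, _, h11, h22, Or.inl fun p hp => Prod.ext ?_ ?_⟩
    · exact eq_mul_fst_of_fderiv hF1 m1 (by simp [F0]) h11 (d1 _) ((d1 _).trans h12) p hp
    · rw [← d2] at h21 h22 ⊢
      exact swap hF2 m2 (by simp [F0]) h21 h22 p hp
  · refine ⟨_, _, h12, h21, Or.inr fun p hp => Prod.ext ?_ ?_⟩
    · rw [← d1] at h11 h12 ⊢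
      exact swap hF1 m1 (by simp [F0]) h11 h12 p hp
    · exact eq_mul_fst_of_fderiv hF2 m2 (by simp [F0]) h21 (d2 _) ((d2 _).trans h22) p hp

/-! ### Matrices `(a, b; b, a)` in terms of their eigenvalues -/

/-- The matrix `(a, b; b, a)` with eigenvalue `u = a + b` on `(1, 1)` and `v = a - b` on
`(1, -1)`. -/
def bidiag {K : Type} [Field K] (u v : K) : Mat2 K :=
  !![(u + v) / 2, (u - v) / 2; (u - v) / 2, (u + v) / 2]

section bidiag

variable {K : Type} [Field K]

lemma bidiag_transpose (u v : K) : (bidiag u v)ᵀ = bidiag u v := by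
  ext i j
  fin_cases i <;> fin_cases j <;> simp [bidiag]

lemma qMat_mul_bidiag (u v : K) : qMat K * bidiag u v = bidiag u v * qMat K := by
  ext i j
  fin_cases i <;> fin_cases j <;> simp [bidiag, qMat, Matrix.mul_apply, Fin.sum_univ_two]

variable [CharZero K]

lemma bidiag_mul (u v u' v' : K) : bidiag u v * bidiag u' v' = bidiag (u * u') (v * v') := by
  ext i j
  fin_cases i <;> fin_cases j <;> simp [bidiag, Matrix.mul_apply, Fin.sum_univ_two] <;> ring

lemma bidiag_add (u v u' v' : K) : bidiag u v + bidiag u' v' = bidiag (u + u') (v + v') := by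
  ext i j
  fin_cases i <;> fin_cases j <;> simp [bidiag] <;> ring

lemma bidiag_sub (u v u' v' : K) : bidiag u v - bidiag u' v' = bidiag (u - u') (v - v') := by
  ext i j
  fin_cases i <;> fin_cases j <;> simp [bidiag] <;> ring

lemma bidiag_self (c : K) : bidiag c c = c • (1 : Mat2 K) := by
  ext i j
  fin_cases i <;> fin_cases j <;> simp [bidiag]

lemma bidiag_one : bidiag 1 1 = (1 : Mat2 K) := by rw [bidiag_self, one_smul]

lemma bidiag_zero : bidiag 0 0 = (0 : Mat2 K) := by rw [bidiag_self, zero_smul]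

lemma bidiag_neg_one : bidiag (-1) (-1) = (-1 : Mat2 K) := by rw [bidiag_self, neg_one_smul]

lemma bidiag_det (u v : K) : (bidiag u v).det = u * v := by
  simp only [bidiag, det_fin_two_of]
  ring

lemma bidiag_inv {u v : K} (hu : u ≠ 0) (hv : v ≠ 0) : (bidiag u v)⁻¹ = bidiag u⁻¹ v⁻¹ := by
  refine inv_eq_left_inv ?_
  rw [bidiag_mul, inv_mul_cancel₀ hu, inv_mul_cancel₀ hv, bidiag_one]

lemma isUnit_bidiag {u v : K} (hu : u ≠ 0) (hv : v ≠ 0) : IsUnit (bidiag u v) := by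
  rw [isUnit_iff_isUnit_det, bidiag_det]
  exact (mul_ne_zero hu hv).isUnit

lemma bidiag_inj {u v u' v' : K} (h : bidiag u v = bidiag u' v') : u = u' ∧ v = v' := by
  have h1 := congrFun (congrFun h 0) 0
  have h2 := congrFun (congrFun h 0) 1
  simp only [bidiag, of_apply, cons_val_zero, cons_val_one] at h1 h2
  constructor
  · linear_combination h1 + h2
  · linear_combination h1 - h2

lemma exists_eq_bidiag {Z : Mat2 K} (h : qMat K * Z = Z * qMat K) : ∃ u v, Z = bidiag u v := by
  have h1 := congrFun (congrFun h 0) 0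
  have h2 := congrFun (congrFun h 0) 1
  simp only [qMat, Matrix.mul_apply, Fin.sum_univ_two, of_apply, cons_val_zero, cons_val_one,
    cons_val', zero_mul, one_mul, mul_zero, mul_one, zero_add, add_zero, cons_val_fin_one] at h1 h2
  refine ⟨Z 0 0 + Z 0 1, Z 0 0 - Z 0 1, ?_⟩
  ext i j
  fin_cases i <;> fin_cases j <;> simp [bidiag, h1, h2]

end bidiag

lemma bisym_eq_bidiag (w : ℂ × ℂ) : bisym w = bidiag (w.1 + w.2) (w.1 - w.2) := by
  ext i j
  fin_cases i <;> fin_cases j <;> simp [bidiag, bisym]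

lemma bidiag_eq_bisym (u v : ℂ) : bidiag u v = bisym ((u + v) / 2, (u - v) / 2) := rfl

lemma bidiag_map_ofReal (s t : ℝ) : (bidiag s t).map Complex.ofReal = bidiag (s : ℂ) t := by
  ext i j
  fin_cases i <;> fin_cases j <;> simp [bidiag]

lemma bidiag_map_im (z w : ℂ) : (bidiag z w).map Complex.im = bidiag z.im w.im := by
  ext i j
  fin_cases i <;> fin_cases j <;> simp [bidiag]

lemma bidiag_map_conj (z w : ℂ) : (bidiag z w).map (starRingEnd ℂ)
    = bidiag (starRingEnd ℂ z) (starRingEnd ℂ w) := by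
  ext i j
  fin_cases i <;> fin_cases j <;> simp [bidiag, map_ofNat]

lemma posDef_bidiag {s t : ℝ} : (bidiag s t).PosDef ↔ 0 < s ∧ 0 < t := by
  have e : ∀ x : Fin 2 → ℝ, star x ⬝ᵥ (bidiag s t *ᵥ x)
      = s * ((x 0 + x 1) ^ 2 / 2) + t * ((x 0 - x 1) ^ 2 / 2) := fun x => by
    simp [bidiag, dotProduct, mulVec, Fin.sum_univ_two]
    ring
  rw [posDef_iff_dotProduct_mulVec]
  simp only [e]
  constructor
  · rintro ⟨-, h⟩
    refine ⟨?_, ?_⟩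
    · have := h (x := ![1, 1]) (fun h => one_ne_zero (congrFun h 0))
      norm_num at this
      linarith
    · have := h (x := ![1, -1]) (fun h => one_ne_zero (congrFun h 0))
      norm_num at this
      linarith
  · rintro ⟨hs, ht⟩
    refine ⟨?_, fun x hx => ?_⟩
    · rw [IsHermitian, conjTranspose_eq_transpose_of_trivial, bidiag_transpose]
    · by_cases h0 : x 0 + x 1 = 0
      · have h3 : x 0 - x 1 ≠ 0 := by
          intro h3
          apply hx
          ext i
          fin_cases i <;> simp <;> linarith
        positivity
      · positivity

lemma bidiag_mem_hatH {z w : ℂ} : bidiag z w ∈ hatH ↔ 0 < z.im ∧ 0 < w.im := by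
  simp only [hatH, siegelH, Set.mem_ofPred_eq, moebius_QMat, bidiag_transpose, qMat_mul_bidiag,
    bidiag_map_im, posDef_bidiag, true_and, and_true]

lemma exists_of_mem_hatH {Z : Mat2 ℂ} (hZ : Z ∈ hatH) :
    ∃ z w : ℂ, 0 < z.im ∧ 0 < w.im ∧ Z = bidiag z w := by
  obtain ⟨z, w, rfl⟩ := exists_eq_bidiag ((moebius_QMat Z).1 hZ.2)
  obtain ⟨h1, h2⟩ := bidiag_mem_hatH.1 hZ
  exact ⟨z, w, h1, h2, rfl⟩

lemma bidiag_mem_hatE {z w : ℂ} : bidiag z w ∈ hatE ↔ ‖z‖ < 1 ∧ ‖w‖ < 1 := by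
  have e : 1 - bidiag z w * (bidiag z w).map (starRingEnd ℂ)
      = (bidiag (1 - ‖z‖ ^ 2) (1 - ‖w‖ ^ 2)).map Complex.ofReal := by
    rw [bidiag_map_conj, bidiag_mul, bidiag_map_ofReal, ← bidiag_one, bidiag_sub,
      Complex.mul_conj', Complex.mul_conj']
    push_cast
    rfl
  have h1 : ∀ z : ℂ, 0 < 1 - ‖z‖ ^ 2 ↔ ‖z‖ < 1 := fun z => by
    rw [sub_pos, sq_lt_one_iff₀ (norm_nonneg z)]
  simp only [hatE, Set.mem_ofPred_eq, qMat_mul_bidiag, true_and]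
  rw [e, posDef_map_ofReal_iff, posDef_bidiag, h1, h1]

lemma exists_of_mem_hatE {Z : Mat2 ℂ} (hZ : Z ∈ hatE) :
    ∃ z w : ℂ, ‖z‖ < 1 ∧ ‖w‖ < 1 ∧ Z = bidiag z w := by
  obtain ⟨z, w, rfl⟩ := exists_eq_bidiag hZ.1
  obtain ⟨h1, h2⟩ := bidiag_mem_hatE.1 hZ
  exact ⟨z, w, h1, h2, rfl⟩

/-! ### Fractional linear maps with complex coefficients -/

/-- `(M N)⟨Z⟩ = M⟨N⟨Z⟩⟩` as soon as the denominator of `N` at `Z` is invertible. The denominator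
of `M` at `N⟨Z⟩` need not be: both sides then contain the same junk inverse. -/
lemma moebius_mul_of_isUnit (M' N' : Mat4 ℂ) {Z : Mat2 ℂ}
    (hV : IsUnit (N'.toBlocks₂₁ * Z + N'.toBlocks₂₂)) :
    moebius (M' * N') Z = moebius M' (moebius N' Z) := by
  rw [isUnit_iff_isUnit_det] at hV
  unfold moebius
  nth_rewrite 1 2 3 4 [← fromBlocks_toBlocks M', ← fromBlocks_toBlocks N']
  simp only [fromBlocks_multiply, toBlocks_fromBlocks₁₁, toBlocks_fromBlocks₁₂,
    toBlocks_fromBlocks₂₁, toBlocks_fromBlocks₂₂]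
  set U := N'.toBlocks₁₁ * Z + N'.toBlocks₁₂ with hU
  set V := N'.toBlocks₂₁ * Z + N'.toBlocks₂₂ with hVd
  have e : ∀ A B : Mat2 ℂ, (A * N'.toBlocks₁₁ + B * N'.toBlocks₂₁) * Z
      + (A * N'.toBlocks₁₂ + B * N'.toBlocks₂₂) = (A * (U * V⁻¹) + B) * V := by
    intro A B
    have e1 : (A * (U * V⁻¹) + B) * V = A * U + B * V := by
      rw [Matrix.add_mul, Matrix.mul_assoc A, Matrix.mul_assoc U, nonsing_inv_mul _ hV,
        Matrix.mul_one]
    rw [e1, hU, hVd]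
    noncomm_ring
  rw [e, e, Matrix.mul_inv_rev, Matrix.mul_assoc, ← Matrix.mul_assoc V, mul_nonsing_inv _ hV,
    Matrix.one_mul]

/-- A matrix with blocks `bidiag` acts on the eigenvalues by two fractional linear maps. -/
lemma moebius_bidiag {a a' b b' c c' d d' z w : ℂ} (h : c * z + d ≠ 0) (h' : c' * w + d' ≠ 0) :
    moebius (fromBlocks (bidiag a a') (bidiag b b') (bidiag c c') (bidiag d d')) (bidiag z w)
      = bidiag ((a * z + b) / (c * z + d)) ((a' * w + b') / (c' * w + d')) := by
  simp only [moebius, toBlocks_fromBlocks₁₁, toBlocks_fromBlocks₁₂, toBlocks_fromBlocks₂₁,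
    toBlocks_fromBlocks₂₂, bidiag_mul, bidiag_add]
  rw [bidiag_inv h h', bidiag_mul, div_eq_mul_inv, div_eq_mul_inv]

/-! ### The Cayley transform -/

/-- The scalar Cayley transform `z ↦ i (1 + z) / (1 - z)` from the disc to the upper half plane. -/
noncomputable def cayley (z : ℂ) : ℂ := Complex.I * (1 + z) / (1 - z)

/-- The inverse `z ↦ (z - i) / (z + i)` of the scalar Cayley transform. -/
noncomputable def cayleyInv (z : ℂ) : ℂ := (z - Complex.I) / (z + Complex.I)

lemma one_sub_ne_zero_of_norm_lt {z : ℂ} (hz : ‖z‖ < 1) : 1 - z ≠ 0 := by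
  intro h
  rw [← sub_eq_zero.1 h, norm_one] at hz
  exact lt_irrefl _ hz

lemma add_I_ne_zero {z : ℂ} (hz : 0 < z.im) : z + Complex.I ≠ 0 := by
  intro h
  have := congrArg Complex.im h
  simp at this
  linarith

lemma cayley_im_pos {z : ℂ} (hz : ‖z‖ < 1) : 0 < (cayley z).im := by
  have h1 := one_sub_ne_zero_of_norm_lt hz
  have h2 : 0 < Complex.normSq (1 - z) := Complex.normSq_pos.2 h1
  have h3 : z.re ^ 2 + z.im ^ 2 < 1 := by
    have := (sq_lt_one_iff₀ (norm_nonneg z)).2 hz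
    rw [Complex.sq_norm, Complex.normSq_apply] at this
    linarith
  have : (cayley z).im = (1 - (z.re ^ 2 + z.im ^ 2)) / Complex.normSq (1 - z) := by
    rw [cayley, Complex.div_im]
    field_simp
    simp
    ring
  rw [this]
  exact div_pos (by linarith) h2

lemma norm_cayleyInv_lt {z : ℂ} (hz : 0 < z.im) : ‖cayleyInv z‖ < 1 := by
  have h := add_I_ne_zero hz
  rw [cayleyInv, norm_div, div_lt_one (norm_pos_iff.2 h),
    ← sq_lt_sq₀ (norm_nonneg _) (norm_nonneg _), Complex.sq_norm, Complex.sq_norm,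
    Complex.normSq_apply, Complex.normSq_apply]
  simp
  nlinarith

lemma cayleyL_val : (cayleyL : Mat4 ℂ) = fromBlocks (bidiag Complex.I Complex.I)
    (bidiag Complex.I Complex.I) (bidiag (-1) (-1)) (bidiag 1 1) := by
  rw [bidiag_neg_one, bidiag_one, bidiag_self]
  rfl

lemma cayleyL_inv_val : ((cayleyL⁻¹ : (Mat4 ℂ)ˣ) : Mat4 ℂ)
    = fromBlocks (bidiag (1 / (2 * Complex.I)) (1 / (2 * Complex.I))) (bidiag (-1 / 2) (-1 / 2))
      (bidiag (1 / (2 * Complex.I)) (1 / (2 * Complex.I))) (bidiag (1 / 2) (1 / 2)) := by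
  simp only [bidiag_self]
  change (1 / (2 * Complex.I)) • fromBlocks 1 (-(Complex.I • 1)) 1 (Complex.I • 1) = _
  rw [fromBlocks_smul, fromBlocks_inj]
  refine ⟨rfl, ?_, rfl, ?_⟩
  · rw [← neg_smul, smul_smul]
    congr 1
    field_simp
  · rw [smul_smul]
    congr 1
    field_simp

lemma moebius_cayleyL {z w : ℂ} (hz : ‖z‖ < 1) (hw : ‖w‖ < 1) :
    moebius cayleyL (bidiag z w) = bidiag (cayley z) (cayley w) := by
  have e : ∀ z : ℂ, -1 * z + 1 = 1 - z := fun z => by ring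
  rw [cayleyL_val, moebius_bidiag]
  · simp only [cayley, e]
    congr 2 <;> ring
  · rw [e]
    exact one_sub_ne_zero_of_norm_lt hz
  · rw [e]
    exact one_sub_ne_zero_of_norm_lt hw

lemma cayleyL_inv_den (z : ℂ) :
    1 / (2 * Complex.I) * z + 1 / 2 = 1 / (2 * Complex.I) * (z + Complex.I) := by
  field_simp

lemma cayleyL_inv_den_ne_zero {z : ℂ} (hz : 0 < z.im) :
    1 / (2 * Complex.I) * z + 1 / 2 ≠ 0 := by
  rw [cayleyL_inv_den]
  exact mul_ne_zero (by simp) (add_I_ne_zero hz)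

lemma moebius_cayleyL_inv {z w : ℂ} (hz : 0 < z.im) (hw : 0 < w.im) :
    moebius (cayleyL⁻¹ : (Mat4 ℂ)ˣ) (bidiag z w) = bidiag (cayleyInv z) (cayleyInv w) := by
  have e : ∀ z : ℂ, (1 / (2 * Complex.I) * z + -1 / 2) / (1 / (2 * Complex.I) * z + 1 / 2)
      = cayleyInv z := fun z => by
    have : 1 / (2 * Complex.I) * z + -1 / 2 = 1 / (2 * Complex.I) * (z - Complex.I) := by
      field_simp
      ring
    rw [cayleyL_inv_den, this, mul_div_mul_left _ _ (by simp), cayleyInv]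
  rw [cayleyL_inv_val, moebius_bidiag (cayleyL_inv_den_ne_zero hz) (cayleyL_inv_den_ne_zero hw),
    e, e]

lemma isUnit_cayleyL_den {Z : Mat2 ℂ} (hZ : Z ∈ hatE) :
    IsUnit ((cayleyL : Mat4 ℂ).toBlocks₂₁ * Z + (cayleyL : Mat4 ℂ).toBlocks₂₂) := by
  obtain ⟨z, w, hz, hw, rfl⟩ := exists_of_mem_hatE hZ
  rw [cayleyL_val, toBlocks_fromBlocks₂₁, toBlocks_fromBlocks₂₂, bidiag_mul, bidiag_add]
  have e : ∀ z : ℂ, -1 * z + 1 = 1 - z := fun z => by ring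
  rw [e, e]
  exact isUnit_bidiag (one_sub_ne_zero_of_norm_lt hz) (one_sub_ne_zero_of_norm_lt hw)

lemma isUnit_cayleyL_inv_den {Z : Mat2 ℂ} (hZ : Z ∈ hatH) :
    IsUnit (((cayleyL⁻¹ : (Mat4 ℂ)ˣ) : Mat4 ℂ).toBlocks₂₁ * Z
      + ((cayleyL⁻¹ : (Mat4 ℂ)ˣ) : Mat4 ℂ).toBlocks₂₂) := by
  obtain ⟨z, w, hz, hw, rfl⟩ := exists_of_mem_hatH hZ
  rw [cayleyL_inv_val, toBlocks_fromBlocks₂₁, toBlocks_fromBlocks₂₂, bidiag_mul, bidiag_add]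
  exact isUnit_bidiag (cayleyL_inv_den_ne_zero hz) (cayleyL_inv_den_ne_zero hw)

lemma moebius_one_matrix (Z : Mat2 ℂ) : moebius 1 Z = Z := by
  simpa using moebius_one Z

/-- The Cayley transform `Z₀ ↦ L⟨Z₀⟩` as a bijection from `Ê₂` onto `Ĥ₂`. -/
noncomputable def cayleyEquiv : hatE ≃ hatH where
  toFun Z := ⟨moebius cayleyL Z, by
    obtain ⟨z, w, hz, hw, h⟩ := exists_of_mem_hatE Z.2
    rw [h, moebius_cayleyL hz hw]
    exact bidiag_mem_hatH.2 ⟨cayley_im_pos hz, cayley_im_pos hw⟩⟩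
  invFun Z := ⟨moebius (cayleyL⁻¹ : (Mat4 ℂ)ˣ) Z, by
    obtain ⟨z, w, hz, hw, h⟩ := exists_of_mem_hatH Z.2
    rw [h, moebius_cayleyL_inv hz hw]
    exact bidiag_mem_hatE.2 ⟨norm_cayleyInv_lt hz, norm_cayleyInv_lt hw⟩⟩
  left_inv Z := Subtype.ext <| by
    change moebius (cayleyL⁻¹ : (Mat4 ℂ)ˣ) (moebius cayleyL Z) = Z
    rw [← moebius_mul_of_isUnit _ _ (isUnit_cayleyL_den Z.2), Units.inv_mul, moebius_one_matrix]
  right_inv Z := Subtype.ext <| by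
    change moebius cayleyL (moebius (cayleyL⁻¹ : (Mat4 ℂ)ˣ) Z) = Z
    rw [← moebius_mul_of_isUnit _ _ (isUnit_cayleyL_inv_den Z.2), Units.mul_inv,
      moebius_one_matrix]

lemma cayleyEquiv_coe (Z : hatE) : (cayleyEquiv Z : Mat2 ℂ) = moebius cayleyL Z := rfl

lemma cayleyEquiv_symm_coe (Z : hatH) :
    (cayleyEquiv.symm Z : Mat2 ℂ) = moebius (cayleyL⁻¹ : (Mat4 ℂ)ˣ) Z := rfl

/-! ### Holomorphic maps and the conjugation of automorphism groups -/

/-- A map between sets of matrices `(a, b; b, a)` is holomorphic if it is so in the coordinates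
`(a, b)`. For `S = T` this is `IsHolo S`. -/
def IsHoloMap (S T : Set (Mat2 ℂ)) (f : S → T) : Prop :=
  ∃ F : ℂ × ℂ → ℂ × ℂ, DifferentiableOn ℂ F {w | bisym w ∈ S} ∧
    ∀ (w : ℂ × ℂ) (hw : bisym w ∈ S), (f ⟨bisym w, hw⟩ : Mat2 ℂ) = bisym (F w)

lemma IsHoloMap.comp {S T R : Set (Mat2 ℂ)} {f : T → R} {g : S → T} (hf : IsHoloMap T R f)
    (hg : IsHoloMap S T g) : IsHoloMap S R (f ∘ g) := by
  obtain ⟨F, hF, hF'⟩ := hf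
  obtain ⟨G, hG, hG'⟩ := hg
  have hm : ∀ w (hw : bisym w ∈ S), bisym (G w) ∈ T := fun w hw => hG' w hw ▸ (g _).2
  refine ⟨F ∘ G, hF.comp hG hm, fun w hw => ?_⟩
  have : g ⟨bisym w, hw⟩ = ⟨bisym (G w), hm w hw⟩ := Subtype.ext (hG' w hw)
  rw [Function.comp_apply, this, hF']
  rfl

lemma isHoloMap_moebius (M : Mat4 ℂ) {S T : Set (Mat2 ℂ)}
    (hS : ∀ Z ∈ S, IsUnit (M.toBlocks₂₁ * Z + M.toBlocks₂₂))
    (hT : ∀ Z ∈ T, qMat ℂ * Z = Z * qMat ℂ) (f : S → T)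
    (hf : ∀ Z : S, (f Z : Mat2 ℂ) = moebius M Z) : IsHoloMap S T f := by
  have hlin : ∀ (A B : Mat2 ℂ) (i j : Fin 2),
      Differentiable ℂ fun w : ℂ × ℂ => (A * bisym w + B) i j := fun A B i j => by
    simp only [bisym, Matrix.add_apply, Matrix.mul_apply, Fin.sum_univ_two, of_apply]
    fin_cases j <;> simp <;> fun_prop
  have hinv : ∀ i j : Fin 2, DifferentiableOn ℂ
      (fun w : ℂ × ℂ => (M.toBlocks₂₁ * bisym w + M.toBlocks₂₂)⁻¹ i j) {w | bisym w ∈ S} := by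
    intro i j
    have hd : DifferentiableOn ℂ
        (fun w : ℂ × ℂ => (M.toBlocks₂₁ * bisym w + M.toBlocks₂₂).det⁻¹) {w | bisym w ∈ S} := by
      refine DifferentiableOn.inv ?_ fun w hw => ?_
      · simp only [det_fin_two]
        have := hlin M.toBlocks₂₁ M.toBlocks₂₂
        exact (((this 0 0).mul (this 1 1)).sub ((this 0 1).mul (this 1 0))).differentiableOn
      · exact ((isUnit_iff_isUnit_det _).1 (hS _ hw)).ne_zero
    have ha : Differentiable ℂ
        fun w : ℂ × ℂ => (M.toBlocks₂₁ * bisym w + M.toBlocks₂₂).adjugate i j := by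
      have := hlin M.toBlocks₂₁ M.toBlocks₂₂
      simp only [adjugate_fin_two]
      fin_cases i <;> fin_cases j
      · exact this 1 1
      · exact (this 0 1).neg
      · exact (this 1 0).neg
      · exact this 0 0
    simp only [inv_def, Ring.inverse_eq_inv', Matrix.smul_apply, smul_eq_mul]
    exact hd.mul ha.differentiableOn
  have hent : ∀ i j : Fin 2, DifferentiableOn ℂ
      (fun w : ℂ × ℂ => moebius M (bisym w) i j) {w | bisym w ∈ S} := by
    intro i j
    simp only [moebius]
    simp only [Matrix.mul_apply (M := _ * _ + _), Fin.sum_univ_two]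
    exact ((hlin _ _ i 0).differentiableOn.mul (hinv 0 j)).add
      ((hlin _ _ i 1).differentiableOn.mul (hinv 1 j))
  refine ⟨fun w => (moebius M (bisym w) 0 0, moebius M (bisym w) 0 1),
    (hent 0 0).prodMk (hent 0 1), fun w hw => ?_⟩
  obtain ⟨u, v, h⟩ := exists_eq_bidiag (hT _ (f ⟨bisym w, hw⟩).2)
  have h' : moebius M (bisym w) = bidiag u v := (hf ⟨bisym w, hw⟩).symm.trans h
  simp only [h, h', bidiag_eq_bisym]
  rfl

lemma isHoloMap_cayleyEquiv : IsHoloMap hatE hatH cayleyEquiv :=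
  isHoloMap_moebius _ (fun _ => isUnit_cayleyL_den) (fun Z hZ => (moebius_QMat Z).1 hZ.2) _
    cayleyEquiv_coe

lemma isHoloMap_cayleyEquiv_symm : IsHoloMap hatH hatE cayleyEquiv.symm :=
  isHoloMap_moebius _ (fun _ => isUnit_cayleyL_inv_den) (fun _ hZ => hZ.1) _ cayleyEquiv_symm_coe

lemma isHolo_conj_hatE {f : hatH → hatH} (hf : IsHolo hatH f) :
    IsHolo hatE (cayleyEquiv.symm ∘ f ∘ cayleyEquiv) :=
  isHoloMap_cayleyEquiv_symm.comp (IsHoloMap.comp (T := hatH) hf isHoloMap_cayleyEquiv)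

lemma isHolo_conj_hatH {f : hatE → hatE} (hf : IsHolo hatE f) :
    IsHolo hatH (cayleyEquiv ∘ f ∘ cayleyEquiv.symm) :=
  isHoloMap_cayleyEquiv.comp (IsHoloMap.comp (T := hatE) hf isHoloMap_cayleyEquiv_symm)

lemma mem_biholGroup {S : Set (Mat2 ℂ)} {f : Equiv.Perm S} :
    f ∈ biholGroup S ↔ IsHolo S f ∧ IsHolo S f.symm := Iff.rfl

lemma conj_mem_biholGroup_hatE {f : Equiv.Perm hatH} (hf : f ∈ biholGroup hatH) :
    (cayleyEquiv.trans f).trans cayleyEquiv.symm ∈ biholGroup hatE := by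
  rw [mem_biholGroup] at hf ⊢
  rw [Equiv.symm_trans, Equiv.symm_trans, Equiv.symm_symm]
  simp only [Equiv.coe_trans]
  exact ⟨isHolo_conj_hatE hf.1, isHolo_conj_hatE hf.2⟩

lemma conj_mem_biholGroup_hatH {f : Equiv.Perm hatE} (hf : f ∈ biholGroup hatE) :
    (cayleyEquiv.symm.trans f).trans cayleyEquiv ∈ biholGroup hatH := by
  rw [mem_biholGroup] at hf ⊢
  rw [Equiv.symm_trans, Equiv.symm_trans, Equiv.symm_symm]
  simp only [Equiv.coe_trans]
  exact ⟨isHolo_conj_hatH hf.1, isHolo_conj_hatH hf.2⟩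

/-- Conjugation with the Cayley transform, an isomorphism from the automorphisms of `Ĥ₂` to
those of `Ê₂`. -/
noncomputable def biholConj : biholGroup hatH ≃* biholGroup hatE where
  toFun f := ⟨(cayleyEquiv.trans f.1).trans cayleyEquiv.symm, conj_mem_biholGroup_hatE f.2⟩
  invFun f := ⟨(cayleyEquiv.symm.trans f.1).trans cayleyEquiv, conj_mem_biholGroup_hatH f.2⟩
  left_inv f := Subtype.ext <| Equiv.ext fun Z => by simp
  right_inv f := Subtype.ext <| Equiv.ext fun Z => by simp
  map_mul' f g := Subtype.ext <| Equiv.ext fun Z => by simp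

lemma biholConj_apply (f : biholGroup hatH) (Z : hatE) :
    (biholConj f : Equiv.Perm hatE) Z = cayleyEquiv.symm (f.1 (cayleyEquiv Z)) := rfl

/-! ### The action of `Ω̂₂` on `Ĥ₂` and its kernel -/

lemma isHolo_moebius_hatH (M : Sp4) (f : hatH → hatH)
    (hf : ∀ Z : hatH, (f Z : Mat2 ℂ) = moebius (complexify M : (Mat4 ℂ)ˣ) Z) : IsHolo hatH f :=
  isHoloMap_moebius _ (fun _ hZ => (moebius_siegelH M hZ.1).1)
    (fun Z hZ => (moebius_QMat Z).1 hZ.2) f hf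

/-- The action of a matrix in `Ω̂₂` as a permutation of `Ĥ₂`. -/
noncomputable def actPerm (M : hatOmega) : Equiv.Perm hatH where
  toFun Z := ⟨moebius (complexify (M : Sp4) : (Mat4 ℂ)ˣ) Z, M.2 Z Z.2⟩
  invFun Z := ⟨moebius (complexify ((M⁻¹ : hatOmega) : Sp4) : (Mat4 ℂ)ˣ) Z, (M⁻¹).2 Z Z.2⟩
  left_inv Z := Subtype.ext <| by
    change moebius _ (moebius _ _) = _
    rw [← moebius_mul _ _ Z.2.1, ← Subgroup.coe_mul, inv_mul_cancel, Subgroup.coe_one, moebius_one]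
  right_inv Z := Subtype.ext <| by
    change moebius _ (moebius _ _) = _
    rw [← moebius_mul _ _ Z.2.1, ← Subgroup.coe_mul, mul_inv_cancel, Subgroup.coe_one, moebius_one]

lemma actPerm_mem (M : hatOmega) : actPerm M ∈ biholGroup hatH :=
  mem_biholGroup.2 ⟨isHolo_moebius_hatH _ _ fun _ => rfl, isHolo_moebius_hatH _ _ fun _ => rfl⟩

/-- The action of `Ω̂₂` on `Ĥ₂` by biholomorphic maps. -/
noncomputable def actH : hatOmega →* biholGroup hatH where
  toFun M := ⟨actPerm M, actPerm_mem M⟩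
  map_one' := Subtype.ext <| Equiv.ext fun Z => Subtype.ext (moebius_one Z)
  map_mul' _ _ := Subtype.ext <| Equiv.ext fun Z => Subtype.ext (moebius_mul _ _ Z.2.1)

lemma actH_apply (M : hatOmega) (Z : hatH) :
    ((actH M : Equiv.Perm hatH) Z : Mat2 ℂ) = moebius (complexify (M : Sp4) : (Mat4 ℂ)ˣ) Z := rfl

/-- A symplectic matrix that fixes `Ĥ₂` pointwise is an involution: its blocks are `A, 0, 0, A`
with `A` symmetric and orthogonal. -/
lemma mul_self_of_fix (N : Sp4) (h : ∀ Z ∈ hatH, moebius (complexify N : (Mat4 ℂ)ˣ) Z = Z) :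
    N * N = 1 := by
  have m1 := mem_hatH_of_real (s := 1) (t := 0) (by norm_num)
  have m2 := mem_hatH_of_real (s := 2) (t := 0) (by norm_num)
  have m3 := mem_hatH_of_real (s := 2) (t := 1) (by norm_num)
  obtain ⟨r1, r1'⟩ := fix_rel N _ m1 (h _ m1)
  obtain ⟨-, r2'⟩ := fix_rel N _ m2 (h _ m2)
  obtain ⟨r3, -⟩ := fix_rel N _ m3 (h _ m3)
  have hN := SymplecticGroup.mem_iff'.1 N.2
  apply Subtype.ext
  change (N : Mat4 ℝ) * (N : Mat4 ℝ) = 1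
  have hb := fromBlocks_toBlocks (N : Mat4 ℝ)
  generalize (N : Mat4 ℝ) = N' at *
  generalize N'.toBlocks₁₁ = A at *
  generalize N'.toBlocks₁₂ = B at *
  generalize N'.toBlocks₂₁ = C at *
  generalize N'.toBlocks₂₂ = D at *
  have hone : (!![1, 0; 0, 1] : Mat2 ℝ) = 1 := one_fin_two.symm
  rw [hone, Matrix.mul_one, Matrix.one_mul] at r1
  rw [hone, Matrix.mul_one, Matrix.one_mul] at r1'
  subst r1
  have hC : C = 0 := by
    rw [r1'] at r2'
    ext i j
    have := congrFun (congrFun r2' i) j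
    rw [Matrix.neg_apply, Matrix.neg_apply, Matrix.mul_apply, Fin.sum_univ_two,
      Matrix.mul_apply, Matrix.mul_apply, Fin.sum_univ_two, Fin.sum_univ_two] at this
    fin_cases i <;> fin_cases j <;> simp at this ⊢ <;> linarith
  subst hC
  rw [neg_zero] at r1'
  subst r1'
  subst hb
  have q1 := congrFun (congrFun r3 0) 0
  have q2 := congrFun (congrFun r3 0) 1
  simp [Matrix.mul_apply, Fin.sum_univ_two] at q1 q2
  have hAT : Aᵀ = A := by
    ext i j
    fin_cases i <;> fin_cases j <;> simp <;> linarith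
  rw [J, fromBlocks_transpose, fromBlocks_multiply, fromBlocks_multiply, fromBlocks_inj] at hN
  have hA : A * A = 1 := by simpa [hAT] using hN.2.2.1
  rw [fromBlocks_multiply, ← fromBlocks_one]
  simp [hA]

lemma mem_fourH (M : hatOmega) : M ∈ fourH ↔ (((M : Sp4) : Mat4 ℝ) = 1 ∨ ((M : Sp4) : Mat4 ℝ) = -1 ∨
    ((M : Sp4) : Mat4 ℝ) = QMat ℝ ∨ ((M : Sp4) : Mat4 ℝ) = -QMat ℝ) := Iff.rfl

lemma complexify_of_eq {M : Sp4} {N : Mat4 ℝ} (h : (M : Mat4 ℝ) = N) :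
    ((complexify M : (Mat4 ℂ)ˣ) : Mat4 ℂ) = N.map Complex.ofReal := by
  rw [complexify_coe, h]

lemma QMat_map : (QMat ℝ).map Complex.ofReal = QMat ℂ := by
  rw [← complexify_QSp, complexify_coe]
  rfl

lemma map_ofReal_neg (N : Mat4 ℝ) : (-N).map Complex.ofReal = -N.map Complex.ofReal := by
  ext i j
  simp

lemma map_ofReal_one : (1 : Mat4 ℝ).map Complex.ofReal = 1 :=
  Matrix.map_one _ Complex.ofReal_zero Complex.ofReal_one

lemma fourH_eq_ker : fourH = actH.ker := by
  ext M
  rw [MonoidHom.mem_ker, mem_fourH]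
  constructor
  · intro h
    refine Subtype.ext <| Equiv.ext fun Z => Subtype.ext ?_
    rw [actH_apply]
    change _ = (Z : Mat2 ℂ)
    rcases h with h | h | h | h <;> rw [complexify_of_eq h]
    · rw [map_ofReal_one, moebius_one_matrix]
    · rw [map_ofReal_neg, moebius_neg, map_ofReal_one, moebius_one_matrix]
    · rw [QMat_map, Z.2.2]
    · rw [map_ofReal_neg, moebius_neg, QMat_map, Z.2.2]
  · intro h
    have hfix : ∀ Z ∈ hatH, moebius (complexify (M : Sp4) : (Mat4 ℂ)ˣ) Z = Z := by
      intro Z hZ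
      have := actH_apply M ⟨Z, hZ⟩
      rw [h] at this
      exact this.symm
    exact eq_of_fix _ (mul_self_of_fix _ hfix) hfix

/-! ### Matrices acting separately on the two eigenvalues -/

/-- The symplectic matrix through which `g` acts on the first and `g'` on the second eigenvalue. -/
noncomputable def pairSp (g g' : SpecialLinearGroup (Fin 2) ℝ) : Sp4 :=
  ⟨fromBlocks (bidiag (g 0 0) (g' 0 0)) (bidiag (g 0 1) (g' 0 1)) (bidiag (g 1 0) (g' 1 0))
    (bidiag (g 1 1) (g' 1 1)), by
    have h := g.det_coe
    have h' := g'.det_coe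
    rw [det_fin_two] at h h'
    rw [SymplecticGroup.mem_iff, J, fromBlocks_transpose, fromBlocks_multiply, fromBlocks_multiply]
    simp only [bidiag_transpose, Matrix.mul_zero, Matrix.mul_one, Matrix.mul_neg, zero_add,
      add_zero, Matrix.neg_mul, bidiag_mul, ← sub_eq_add_neg, bidiag_sub]
    rw [fromBlocks_inj, ← bidiag_neg_one, ← bidiag_one, ← bidiag_zero]
    refine ⟨?_, ?_, ?_, ?_⟩ <;> congr 1 <;> linarith⟩

/-- The symplectic matrix that exchanges the two eigenvalues. -/
def swapSp : Sp4 :=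
  ⟨fromBlocks !![1, 0; 0, -1] 0 0 !![1, 0; 0, -1], by
    have h : (!![1, 0; 0, -1] : Mat2 ℝ)ᵀ = !![1, 0; 0, -1] := by
      ext i j
      fin_cases i <;> fin_cases j <;> simp
    have h2 : (!![1, 0; 0, -1] : Mat2 ℝ) * !![1, 0; 0, -1] = 1 := by simp [one_fin_two]
    rw [SymplecticGroup.mem_iff, J, fromBlocks_transpose, fromBlocks_multiply, fromBlocks_multiply]
    simp only [h, h2, transpose_zero, Matrix.mul_zero, Matrix.zero_mul, Matrix.mul_one,
      Matrix.mul_neg, Matrix.neg_mul, zero_add, add_zero, neg_zero]⟩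

lemma pairSp_mem (g g' : SpecialLinearGroup (Fin 2) ℝ) : pairSp g g' ∈ hatOmega := by
  refine (maps_hatH_iff _).2 (Or.inl ?_)
  simp only [pairSp, QMat]
  rw [fromBlocks_multiply, fromBlocks_multiply]
  simp [qMat_mul_bidiag]

lemma swapSp_mem : swapSp ∈ hatOmega := by
  refine (maps_hatH_iff _).2 (Or.inr ?_)
  simp only [swapSp, QMat]
  rw [fromBlocks_multiply, fromBlocks_multiply, fromBlocks_neg]
  simp [qMat]

lemma den_ne_zero (g : SpecialLinearGroup (Fin 2) ℝ) {z : ℂ} (hz : 0 < z.im) :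
    (g 1 0 : ℂ) * z + g 1 1 ≠ 0 := by
  intro h
  have h1 := congrArg Complex.im h
  have h2 := congrArg Complex.re h
  have h3 := g.det_coe
  simp only [Complex.add_im, Complex.mul_im, Complex.ofReal_re, Complex.ofReal_im, zero_mul,
    add_zero, Complex.zero_im, mul_eq_zero, hz.ne', or_false] at h1
  rw [h1] at h2
  simp at h2
  rw [det_fin_two, h1, h2] at h3
  simp at h3

lemma moebius_pairSp (g g' : SpecialLinearGroup (Fin 2) ℝ) {z w : ℂ} (hz : 0 < z.im)
    (hw : 0 < w.im) : moebius (complexify (pairSp g g') : (Mat4 ℂ)ˣ) (bidiag z w)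
      = bidiag ((g 0 0 * z + g 0 1) / (g 1 0 * z + g 1 1))
        ((g' 0 0 * w + g' 0 1) / (g' 1 0 * w + g' 1 1)) := by
  rw [complexify_coe]
  simp only [pairSp, fromBlocks_map, bidiag_map_ofReal]
  exact moebius_bidiag (den_ne_zero g hz) (den_ne_zero g' hw)

lemma moebius_swapSp (z w : ℂ) :
    moebius (complexify swapSp : (Mat4 ℂ)ˣ) (bidiag z w) = bidiag w z := by
  have h2 : (!![1, 0; 0, -1] : Mat2 ℂ) * !![1, 0; 0, -1] = 1 := by simp [one_fin_two]
  have h : (!![1, 0; 0, -1] : Mat2 ℝ).map Complex.ofReal = !![1, 0; 0, -1] := by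
    ext i j
    fin_cases i <;> fin_cases j <;> simp
  rw [complexify_coe]
  simp only [swapSp, fromBlocks_map, h, moebius, toBlocks_fromBlocks₁₁, toBlocks_fromBlocks₁₂,
    toBlocks_fromBlocks₂₁, toBlocks_fromBlocks₂₂]
  rw [inv_eq_left_inv (B := !![1, 0; 0, -1]) (by ext i j; fin_cases i <;> fin_cases j <;> simp)]
  ext i j
  fin_cases i <;> fin_cases j <;>
    simp [bidiag, Matrix.mul_apply, Fin.sum_univ_two] <;> ring

/-- `SL(2, ℝ)` acts transitively on the upper half plane. -/
lemma exists_map_to_I {z : ℂ} (hz : 0 < z.im) : ∃ g : SpecialLinearGroup (Fin 2) ℝ,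
    ((g 0 0 : ℂ) * z + g 0 1) / (g 1 0 * z + g 1 1) = Complex.I := by
  have hs : Real.sqrt z.im ≠ 0 := (Real.sqrt_pos.2 hz).ne'
  refine ⟨⟨!![(Real.sqrt z.im)⁻¹, -z.re / Real.sqrt z.im; 0, Real.sqrt z.im], ?_⟩, ?_⟩
  · rw [det_fin_two_of]
    field_simp
    ring
  · have hsc : (Real.sqrt z.im : ℂ) ≠ 0 := by exact_mod_cast hs
    have h2 : (Real.sqrt z.im : ℂ) ^ 2 = z.im := by
      exact_mod_cast Real.sq_sqrt hz.le
    have h3 := Complex.re_add_im z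
    simp
    field_simp
    rw [h2]
    linear_combination -h3

/-- Under the Cayley transform, the rotations of the disc are induced by the rotations in
`SL(2, ℝ)`: the matrix `(c, s; -s, c)` induces the rotation by `(c + i s)²`. -/
lemma exists_rotation {α : ℂ} (hα : ‖α‖ = 1) : ∃ g : SpecialLinearGroup (Fin 2) ℝ,
    ∀ z : ℂ, ‖z‖ < 1 →
      ((g 0 0 : ℂ) * cayley z + g 0 1) / (g 1 0 * cayley z + g 1 1) = cayley (α * z) := by
  obtain ⟨ε, hε⟩ := IsAlgClosed.exists_pow_nat_eq α (n := 2) two_pos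
  have hn : ‖ε‖ = 1 := by
    have : ‖ε‖ ^ 2 = 1 := by rw [← norm_pow, hε, hα]
    exact (pow_eq_one_iff_of_nonneg (norm_nonneg ε) two_ne_zero).1 this
  have hcs : ε.re ^ 2 + ε.im ^ 2 = 1 := by
    have := Complex.sq_norm ε
    rw [hn, Complex.normSq_apply] at this
    linarith
  refine ⟨⟨!![ε.re, ε.im; -ε.im, ε.re], by rw [det_fin_two_of]; linarith⟩, fun z hz => ?_⟩
  have hden := den_ne_zero ⟨!![ε.re, ε.im; -ε.im, ε.re], by rw [det_fin_two_of]; linarith⟩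
    (cayley_im_pos hz)
  have h1 := one_sub_ne_zero_of_norm_lt hz
  have h2 : 1 - α * z ≠ 0 := one_sub_ne_zero_of_norm_lt (by rwa [norm_mul, hα, one_mul])
  have hcs' : (ε.re : ℂ) ^ 2 + (ε.im : ℂ) ^ 2 = 1 := by exact_mod_cast hcs
  have hα' : α = (ε.re + ε.im * Complex.I) ^ 2 := by rw [Complex.re_add_im, hε]
  have hI := Complex.I_sq
  simp at hden ⊢
  rw [div_eq_iff hden, cayley, cayley]
  rw [hα'] at h2 ⊢
  generalize (ε.re : ℂ) = c at *
  generalize (ε.im : ℂ) = s at *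
  have e1 : c * Complex.I * (1 + z) + (1 - z) * s
      = Complex.I * ((c - s * Complex.I) + z * (c + s * Complex.I)) := by
    linear_combination s * (1 - z) * hI
  have e2 : -(Complex.I * (1 + z) * s) + c * (1 - z)
      = (c - s * Complex.I) - z * (c + s * Complex.I) := by ring
  have e3 : (c - s * Complex.I) * (c + s * Complex.I) = 1 := by
    linear_combination hcs' - s ^ 2 * hI
  field_simp
  rw [eq_div_iff (by convert h2 using 1; ring), e1, e2]
  linear_combination (-2 * Complex.I * z * (c + s * Complex.I)) * e3

/-! ### Automorphisms of `Ê₂` that fix the origin, and surjectivity of the action -/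

lemma bidiag_mem_hatE_iff_mem_ball (p : ℂ × ℂ) :
    bidiag p.1 p.2 ∈ hatE ↔ p ∈ Metric.ball (0 : ℂ × ℂ) 1 := by
  rw [bidiag_mem_hatE, mem_ball_zero_iff, Prod.norm_def, max_lt_iff]

/-- In terms of the eigenvalues, a holomorphic self-map of `Ê₂` is a holomorphic function on the
bidisc. -/
lemma exists_eigenvalue_map {f : hatE → hatE} (hf : IsHolo hatE f) :
    ∃ F : ℂ × ℂ → ℂ × ℂ, DifferentiableOn ℂ F (Metric.ball 0 1) ∧
      ∀ (p : ℂ × ℂ) (hp : bidiag p.1 p.2 ∈ hatE),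
        (f ⟨bidiag p.1 p.2, hp⟩ : Mat2 ℂ) = bidiag (F p).1 (F p).2 := by
  obtain ⟨F, hF, hF'⟩ := hf
  refine ⟨fun p => ((F ((p.1 + p.2) / 2, (p.1 - p.2) / 2)).1
    + (F ((p.1 + p.2) / 2, (p.1 - p.2) / 2)).2,
    (F ((p.1 + p.2) / 2, (p.1 - p.2) / 2)).1 - (F ((p.1 + p.2) / 2, (p.1 - p.2) / 2)).2),
    ?_, fun p hp => ?_⟩
  · have hc : DifferentiableOn ℂ (fun p : ℂ × ℂ => F ((p.1 + p.2) / 2, (p.1 - p.2) / 2))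
        (Metric.ball 0 1) :=
      DifferentiableOn.comp (f := fun p : ℂ × ℂ => ((p.1 + p.2) / 2, (p.1 - p.2) / 2)) hF
        (Differentiable.differentiableOn (by fun_prop)) fun p hp => by
          rw [← bidiag_mem_hatE_iff_mem_ball, bidiag_eq_bisym] at hp
          exact hp
    exact (hc.fst.fun_add hc.snd).prodMk (hc.fst.fun_sub hc.snd)
  · rw [← bisym_eq_bidiag]
    simp only [bidiag_eq_bisym p.1 p.2] at hp ⊢
    exact hF' _ hp

/-- A biholomorphic self-map of `Ê₂` that fixes the origin rotates the eigenvalues, and possibly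
exchanges them. -/
lemma hatE_fixing_zero {f : Equiv.Perm hatE} (hf : f ∈ biholGroup hatE)
    (h0 : ∀ hm : bidiag 0 0 ∈ hatE, (f ⟨bidiag 0 0, hm⟩ : Mat2 ℂ) = bidiag 0 0) :
    ∃ α β : ℂ, ‖α‖ = 1 ∧ ‖β‖ = 1 ∧
      ((∀ (z w : ℂ) (h : bidiag z w ∈ hatE),
          (f ⟨bidiag z w, h⟩ : Mat2 ℂ) = bidiag (α * z) (β * w)) ∨
       (∀ (z w : ℂ) (h : bidiag z w ∈ hatE),
          (f ⟨bidiag z w, h⟩ : Mat2 ℂ) = bidiag (α * w) (β * z))) := by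
  obtain ⟨F, hF, hF'⟩ := exists_eigenvalue_map (mem_biholGroup.1 hf).1
  obtain ⟨G, hG, hG'⟩ := exists_eigenvalue_map (mem_biholGroup.1 hf).2
  have mF : Set.MapsTo F (Metric.ball 0 1) (Metric.ball 0 1) := fun p hp => by
    rw [← bidiag_mem_hatE_iff_mem_ball] at hp ⊢
    rw [← hF' p hp]
    exact (f _).2
  have mG : Set.MapsTo G (Metric.ball 0 1) (Metric.ball 0 1) := fun p hp => by
    rw [← bidiag_mem_hatE_iff_mem_ball] at hp ⊢
    rw [← hG' p hp]
    exact (f.symm _).2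
  have hGF : ∀ p ∈ Metric.ball (0 : ℂ × ℂ) 1, G (F p) = p := by
    intro p hp
    have hp1 := (bidiag_mem_hatE_iff_mem_ball p).2 hp
    have hp2 := (bidiag_mem_hatE_iff_mem_ball _).2 (mF hp)
    have h1 : f ⟨bidiag p.1 p.2, hp1⟩ = ⟨bidiag (F p).1 (F p).2, hp2⟩ := Subtype.ext (hF' p hp1)
    have h2 := hG' (F p) hp2
    rw [← h1, Equiv.symm_apply_apply] at h2
    obtain ⟨e1, e2⟩ := bidiag_inj h2
    exact Prod.ext e1.symm e2.symm
  have F0 : F 0 = 0 := by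
    have hm : bidiag (0 : ℂ × ℂ).1 (0 : ℂ × ℂ).2 ∈ hatE :=
      (bidiag_mem_hatE_iff_mem_ball 0).2 (Metric.mem_ball_self one_pos)
    obtain ⟨e1, e2⟩ := bidiag_inj ((hF' 0 hm).symm.trans (h0 hm))
    exact Prod.ext e1 e2
  obtain ⟨α, β, hα, hβ, h⟩ := bidisc_fixing_zero hF hG mF mG hGF F0
  refine ⟨α, β, hα, hβ, h.imp (fun h z w hzw => ?_) (fun h z w hzw => ?_)⟩
  all_goals rw [hF' (z, w) hzw, h _ ((bidiag_mem_hatE_iff_mem_ball (z, w)).1 hzw)]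

lemma cayley_zero : cayley 0 = Complex.I := by simp [cayley]

lemma cayleyEquiv_bidiag {z w : ℂ} (h : bidiag z w ∈ hatE) :
    (cayleyEquiv ⟨bidiag z w, h⟩ : Mat2 ℂ) = bidiag (cayley z) (cayley w) :=
  moebius_cayleyL (bidiag_mem_hatE.1 h).1 (bidiag_mem_hatE.1 h).2

/-- An automorphism of `Ĥ₂` that fixes the point `i I` is induced by a matrix in `Ω̂₂`. -/
lemma exists_actH_of_fixing_I {f : biholGroup hatH}
    (h0 : ∀ Z : hatH, (Z : Mat2 ℂ) = bidiag Complex.I Complex.I → (f : Equiv.Perm hatH) Z = Z) :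
    ∃ M, actH M = f := by
  have hE0 : ∀ hm : bidiag 0 0 ∈ hatE,
      ((biholConj f : Equiv.Perm hatE) ⟨bidiag 0 0, hm⟩ : Mat2 ℂ) = bidiag 0 0 := by
    intro hm
    rw [biholConj_apply, h0 _ (by rw [cayleyEquiv_bidiag, cayley_zero]), Equiv.symm_apply_apply]
  obtain ⟨α, β, hα, hβ, h⟩ := hatE_fixing_zero (biholConj f).2 hE0
  obtain ⟨g, hg⟩ := exists_rotation hα
  obtain ⟨g', hg'⟩ := exists_rotation hβ
  have key : ∀ M : hatOmega, (∀ (z w : ℂ) (hzw : bidiag z w ∈ hatE),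
      moebius (complexify (M : Sp4) : (Mat4 ℂ)ˣ) (bidiag (cayley z) (cayley w))
        = cayleyEquiv ((biholConj f : Equiv.Perm hatE) ⟨bidiag z w, hzw⟩)) → actH M = f := by
    intro M hM
    refine Subtype.ext <| Equiv.ext fun Z => Subtype.ext ?_
    obtain ⟨Z₀, rfl⟩ := cayleyEquiv.surjective Z
    obtain ⟨Z₀, hZ₀⟩ := Z₀
    obtain ⟨z, w, -, -, rfl⟩ := exists_of_mem_hatE hZ₀
    rw [actH_apply, cayleyEquiv_bidiag, hM z w hZ₀, biholConj_apply, Equiv.apply_symm_apply]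
  have rot : ∀ z : ℂ, ‖z‖ < 1 → ∀ α : ℂ, ‖α‖ = 1 → ‖α * z‖ < 1 := fun z hz α hα => by
    rwa [norm_mul, hα, one_mul]
  rcases h with h | h
  · refine ⟨⟨pairSp g g', pairSp_mem g g'⟩, key _ fun z w hzw => ?_⟩
    obtain ⟨hz, hw⟩ := bidiag_mem_hatE.1 hzw
    rw [moebius_pairSp _ _ (cayley_im_pos hz) (cayley_im_pos hw), hg z hz, hg' w hw,
      cayleyEquiv_coe, h, moebius_cayleyL (rot z hz α hα) (rot w hw β hβ)]
  · refine ⟨⟨pairSp g g', pairSp_mem g g'⟩ * ⟨swapSp, swapSp_mem⟩, key _ fun z w hzw => ?_⟩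
    obtain ⟨hz, hw⟩ := bidiag_mem_hatE.1 hzw
    have hm := bidiag_mem_hatH.2 ⟨cayley_im_pos hz, cayley_im_pos hw⟩
    rw [Subgroup.coe_mul, moebius_mul _ _ hm.1, moebius_swapSp,
      moebius_pairSp _ _ (cayley_im_pos hw) (cayley_im_pos hz), hg w hw, hg' z hz,
      cayleyEquiv_coe, h, moebius_cayleyL (rot w hw α hα) (rot z hz β hβ)]

/-- Every automorphism of `Ĥ₂` comes from `Ω̂₂`: by transitivity it can be composed with an element
of `Ω̂₂` so as to fix `i I`. -/
lemma actH_surjective : Function.Surjective actH := by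
  intro f
  have hI : bidiag Complex.I Complex.I ∈ hatH := bidiag_mem_hatH.2 ⟨by simp, by simp⟩
  obtain ⟨u, v, hu, hv, huv⟩ := exists_of_mem_hatH ((f : Equiv.Perm hatH) ⟨_, hI⟩).2
  obtain ⟨g, hg⟩ := exists_map_to_I hu
  obtain ⟨g', hg'⟩ := exists_map_to_I hv
  obtain ⟨M, hM⟩ := exists_actH_of_fixing_I (f := actH ⟨pairSp g g', pairSp_mem g g'⟩ * f) (by
    rintro ⟨Z, hZ⟩ hZI
    change Z = _ at hZI
    subst hZI
    apply Subtype.ext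
    rw [Subgroup.coe_mul, Equiv.Perm.mul_apply, actH_apply, huv, moebius_pairSp _ _ hu hv, hg, hg'])
  exact ⟨(⟨pairSp g g', pairSp_mem g g'⟩ : hatOmega)⁻¹ * M, by
    rw [map_mul, map_inv, hM, inv_mul_cancel_left]⟩

/-! ### Transport to `Ê₂` -/

lemma complexify_injective : Function.Injective complexify := by
  intro M N h
  apply Subtype.ext
  have h' := congrArg (Units.val) h
  rw [complexify_coe, complexify_coe] at h'
  exact map_injective Complex.ofReal_injective h'

lemma conjL_eq (M : Sp4) : conjL M = cayleyL⁻¹ * complexify M * cayleyL := by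
  simp [conjL]

lemma conjL_injective : Function.Injective conjL :=
  (MulAut.conj cayleyL⁻¹).injective.comp complexify_injective

/-- The isomorphism `M ↦ L⁻¹ M L` from `Ω̂₂` onto the motion group of `Ê₂`. -/
noncomputable def omegaEquiv : hatOmega ≃* hatOmegaE :=
  hatOmega.equivMapOfInjective conjL conjL_injective

lemma omegaEquiv_coe (M : hatOmega) :
    (omegaEquiv M : (Mat4 ℂ)ˣ) = cayleyL⁻¹ * complexify (M : Sp4) * cayleyL :=
  conjL_eq M

lemma moebius_omegaEquiv (M : hatOmega) (Z₀ : hatE) :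
    moebius (omegaEquiv M : (Mat4 ℂ)ˣ) Z₀
      = ((biholConj (actH M) : Equiv.Perm hatE) Z₀ : Mat2 ℂ) := by
  rw [omegaEquiv_coe, Units.val_mul, moebius_mul_of_isUnit _ _ (isUnit_cayleyL_den Z₀.2),
    ← cayleyEquiv_coe, Units.val_mul,
    moebius_mul_of_isUnit _ _ (moebius_siegelH M (cayleyEquiv Z₀).2.1).1, ← actH_apply,
    ← cayleyEquiv_symm_coe, biholConj_apply]

/-- The action of the motion group of `Ê₂` on `Ê₂` by biholomorphic maps. -/
noncomputable def actE : hatOmegaE →* biholGroup hatE :=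
  (biholConj.toMonoidHom.comp actH).comp omegaEquiv.symm.toMonoidHom

lemma actE_apply (M₀ : hatOmegaE) (Z₀ : hatE) :
    ((actE M₀ : Equiv.Perm hatE) Z₀ : Mat2 ℂ) = moebius (M₀ : (Mat4 ℂ)ˣ) Z₀ := by
  obtain ⟨M, rfl⟩ := omegaEquiv.surjective M₀
  rw [moebius_omegaEquiv]
  simp [actE]

lemma actE_surjective : Function.Surjective actE :=
  (biholConj.surjective.comp actH_surjective).comp omegaEquiv.symm.surjective

lemma cayleyL_mul_QMat : (cayleyL : Mat4 ℂ) * QMat ℂ = QMat ℂ * (cayleyL : Mat4 ℂ) := by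
  rw [cayleyL_val, QMat, fromBlocks_multiply, fromBlocks_multiply]
  simp [qMat_mul_bidiag]

/-- Conjugation with `L` identifies the two copies of `{±I, ±Q}`, since `L` commutes with `Q`. -/
lemma omegaEquiv_mem_fourE (M : hatOmega) : omegaEquiv M ∈ fourE ↔ M ∈ fourH := by
  have hiff : ∀ N : Mat4 ℝ, (cayleyL : Mat4 ℂ) * N.map Complex.ofReal
      = N.map Complex.ofReal * (cayleyL : Mat4 ℂ) →
      (((omegaEquiv M : (Mat4 ℂ)ˣ) : Mat4 ℂ) = N.map Complex.ofReal ↔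
        ((M : Sp4) : Mat4 ℝ) = N) := by
    intro N hN
    rw [omegaEquiv_coe, mul_assoc, Units.val_mul, Units.inv_mul_eq_iff_eq_mul, hN, Units.val_mul,
      Units.mul_left_inj, complexify_coe]
    exact (map_injective Complex.ofReal_injective).eq_iff
  have h1 := hiff 1 (by rw [map_ofReal_one, Matrix.mul_one, Matrix.one_mul])
  have h2 := hiff (-1) (by rw [map_ofReal_neg, map_ofReal_one]; simp)
  have h3 := hiff (QMat ℝ) (by rw [QMat_map, cayleyL_mul_QMat])
  have h4 := hiff (-QMat ℝ) (by
    rw [map_ofReal_neg, QMat_map, Matrix.mul_neg, Matrix.neg_mul, cayleyL_mul_QMat])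
  rw [map_ofReal_one] at h1
  rw [map_ofReal_neg, map_ofReal_one] at h2
  rw [QMat_map] at h3
  rw [map_ofReal_neg, QMat_map] at h4
  rw [mem_fourH, ← h1, ← h2, ← h3, ← h4]
  rfl

lemma fourE_eq_ker : fourE = actE.ker := by
  ext M₀
  obtain ⟨M, rfl⟩ := omegaEquiv.surjective M₀
  rw [omegaEquiv_mem_fourE, fourH_eq_ker, MonoidHom.mem_ker, MonoidHom.mem_ker]
  simp [actE]

/-! ### The quotients by `{±I, ±Q}` -/

/-- The first isomorphism theorem, with the formula for the isomorphism on classes. -/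
lemma exists_quotient_equiv {G H : Type*} [Group G] [Group H] {φ : G →* H}
    (hφ : Function.Surjective φ) {N : Subgroup G} [N.Normal] (h : N = φ.ker) :
    ∃ e : G ⧸ N ≃* H, ∀ g : G, e (g : G ⧸ N) = φ g := by
  subst h
  exact ⟨QuotientGroup.quotientKerEquivOfSurjective φ hφ, fun _ => rfl⟩

theorem theorem3 :
    (∀ f ∈ biholGroup hatE, ∃ M₀ ∈ hatOmegaE, ∀ Z₀ : hatE,
      ((f Z₀ : hatE) : Mat2 ℂ) = moebius (M₀ : Mat4 ℂ) Z₀) ∧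
    (∀ f ∈ biholGroup hatH, ∃ M ∈ hatOmega, ∀ Z : hatH,
      ((f Z : hatH) : Mat2 ℂ) = moebius (complexify M : (Mat4 ℂ)ˣ) Z) ∧
    ∃ (_ : fourH.Normal) (_ : fourE.Normal),
      (∃ e : hatOmegaE ⧸ fourE ≃* biholGroup hatE, ∀ (M₀ : hatOmegaE) (Z₀ : hatE),
        (((e (M₀ : hatOmegaE ⧸ fourE) : Equiv.Perm hatE) Z₀ : hatE) : Mat2 ℂ)
          = moebius (M₀ : (Mat4 ℂ)ˣ) Z₀) ∧
      (∃ e : hatOmega ⧸ fourH ≃* biholGroup hatH, ∀ (M : hatOmega) (Z : hatH),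
        (((e (M : hatOmega ⧸ fourH) : Equiv.Perm hatH) Z : hatH) : Mat2 ℂ)
          = moebius (complexify (M : Sp4) : (Mat4 ℂ)ˣ) Z) ∧
      (∃ e : hatOmega ⧸ fourH ≃* biholGroup hatE, ∀ (M : hatOmega) (Z₀ : hatE),
        (((e (M : hatOmega ⧸ fourH) : Equiv.Perm hatE) Z₀ : hatE) : Mat2 ℂ)
          = moebius (cayleyL⁻¹ * complexify (M : Sp4) * cayleyL : (Mat4 ℂ)ˣ) Z₀) ∧
      (∃ e : hatOmegaE ⧸ fourE ≃* biholGroup hatH, ∀ (M₀ : hatOmegaE) (Z : hatH),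
        (((e (M₀ : hatOmegaE ⧸ fourE) : Equiv.Perm hatH) Z : hatH) : Mat2 ℂ)
          = moebius (cayleyL * M₀ * cayleyL⁻¹ : (Mat4 ℂ)ˣ) Z) := by
  refine ⟨fun f hf => ?_, fun f hf => ?_, ?_⟩
  · obtain ⟨M₀, hM₀⟩ := actE_surjective ⟨f, hf⟩
    refine ⟨M₀, M₀.2, fun Z₀ => ?_⟩
    rw [← actE_apply, hM₀]
  · obtain ⟨M, hM⟩ := actH_surjective ⟨f, hf⟩
    refine ⟨M, M.2, fun Z => ?_⟩
    rw [← actH_apply, hM]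
  · have nH : fourH.Normal := by
      rw [fourH_eq_ker]
      infer_instance
    have nE : fourE.Normal := by
      rw [fourE_eq_ker]
      infer_instance
    obtain ⟨eE, hE⟩ := exists_quotient_equiv actE_surjective fourE_eq_ker
    obtain ⟨eH, hH⟩ := exists_quotient_equiv actH_surjective fourH_eq_ker
    refine ⟨nH, nE, ⟨eE, fun M₀ Z₀ => ?_⟩, ⟨eH, fun M Z => ?_⟩,
      ⟨eH.trans biholConj, fun M Z₀ => ?_⟩,
      ⟨eE.trans biholConj.symm, fun M₀ Z => ?_⟩⟩
    · rw [hE, actE_apply]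
    · rw [hH, actH_apply]
    · rw [← omegaEquiv_coe, moebius_omegaEquiv, MulEquiv.trans_apply, hH]
    · obtain ⟨M, rfl⟩ := omegaEquiv.surjective M₀
      have e : cayleyL * (omegaEquiv M : (Mat4 ℂ)ˣ) * cayleyL⁻¹ = complexify (M : Sp4) := by
        rw [omegaEquiv_coe]
        group
      rw [e, ← actH_apply, MulEquiv.trans_apply, hE]
      simp [actE]
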